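/- A \emph{meromorphic end} is a harmonic map $f=\operatorname{Re}\int^z(\omega_1,\omega_2,\omega_3):\mathbb{D}^*\to\mathbb{R}^3$ on the punctured unit disk $\mathbb{D}^*=\{0<|z|<1\}$, where $\omega_1,\omega_2,\omega_3$ are holomorphic 1-forms on $\mathbb{D}^*$, meromorphic at $0$, and $f$ is single-valued. Let $n_k\ge 0$ be the pole order of $\omega_k$ at $0$ (with $n_k=0$ if $\omega_k$ extends holomorphically to $0$). Two ends $f,\tilde f$ are affinely equivalent if $\tilde f=A\circ f$ for an invertible affine map $A:\mathbb{R}^3\to\mathbb{R}^3$. An end is \emph{reduced} if $n_1\le n_2\le n_3$ and $(n_1,n_2,n_3)$ is lexicographically minimal among all affinely equivalent ends; the \emph{type} of an end is the tuple $(n_1,n_2,n_3)$ of an affinely equivalent reduced end, and its \emph{order} is the last entry of its type. Properties of ends are understood near the puncture: an end is \emph{proper} (resp. \emph{injective}) if for some $r\in(0,1)$ the restriction of $f$ to $\{0<|z|\le r\}$ is a proper map into $\mathbb{R}^3$ (resp. injective), and \emph{properly embedded} if for some $r\in(0,1)$ this restriction is a proper injective immersion. \textbf{Theorem (ends of order 3).}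 Every end of order $3$ has exactly one type, and it is one of $(2,2,3)$, $(1,2,3)$, $(0,2,3)$, $(0,1,3)$, $(2,3,3)$, $(1,3,3)$, $(0,3,3)$, $(0,0,3)$. Moreover: \begin{enumerate} \item Ends of type $(2,2,3)$ exist, and every end of type $(2,2,3)$ is properly embedded. \item For each of the types $(1,2,3)$, $(0,2,3)$, $(0,1,3)$ there are reduced ends of this type that are properly embedded, and reduced ends of this type that are not properly embedded. \item Ends of type $(2,3,3)$, $(1,3,3)$, $(0,3,3)$ or $(0,0,3)$ are never properly embedded. More precisely, ends of type $(2,3,3)$, $(1,3,3)$ or $(0,3,3)$ are never injective, and ends of type $(0,0,3)$ are never proper. \end{enumerate} -/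

import Mathlib

/-- The punctured unit disk `𝔻* = {z : 0 < |z| < 1}`. -/
def puncturedDisk : Set ℂ := {z | 0 < ‖z‖ ∧ ‖z‖ < 1}

/-- The closed punctured disk `{z : 0 < |z| ≤ r}`, a neighbourhood of the puncture. -/
def closedPuncturedDisk (r : ℝ) : Set ℂ := {z | 0 < ‖z‖ ∧ ‖z‖ ≤ r}

/-- A meromorphic end `f = Re ∫ (ω₁, ω₂, ω₃) : 𝔻* → ℝ³`, where the 1-forms `ω_k = form k · dz` are
holomorphic in `𝔻*` and meromorphic at `0`. That `f` is a (single-valued) real part of a primitive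
of the forms means that the real differential of its `k`-th coordinate at `z` is
`v ↦ Re (form k z * v)`. Only the values on `𝔻*` matter. -/
structure MeromorphicEnd where
  /-- The harmonic map `f`. -/
  toFun : ℂ → EuclideanSpace ℝ (Fin 3)
  /-- The coefficient functions of the 1-forms. -/
  form : Fin 3 → ℂ → ℂ
  form_holomorphic : ∀ k, DifferentiableOn ℂ (form k) puncturedDisk
  form_meromorphic : ∀ k, MeromorphicAt (form k) 0
  hasFDerivAt_toFun : ∀ k, ∀ z ∈ puncturedDisk,
    HasFDerivAt (fun w : ℂ => toFun w k)
      (Complex.reCLM.comp (ContinuousLinearMap.mul ℝ ℂ (form k z))) z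

namespace MeromorphicEnd

/-- The orders `(n₁, n₂, n₃)` of the poles of the three forms at `0`; a form that extends
holomorphically to `0` (possibly the zero form) has pole order `0`. -/
noncomputable def poleOrders (e : MeromorphicEnd) : Fin 3 → ℕ :=
  fun k => (-(meromorphicOrderAt (e.form k) 0).untop₀).toNat

/-- `e'` arises from `e` by a regular affine transformation of `ℝ³`. -/
def AffinelyEquivalent (e e' : MeromorphicEnd) : Prop :=
  ∃ A : EuclideanSpace ℝ (Fin 3) ≃ᵃ[ℝ] EuclideanSpace ℝ (Fin 3),
    ∀ z ∈ puncturedDisk, e'.toFun z = A (e.toFun z)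

/-- Reduced form: `n₁ ≤ n₂ ≤ n₃`, and `(n₁, n₂, n₃)` is lexicographically minimal among all
affinely equivalent ends. -/
def IsReduced (e : MeromorphicEnd) : Prop :=
  Monotone e.poleOrders ∧
    ∀ e' : MeromorphicEnd, e.AffinelyEquivalent e' → toLex e.poleOrders ≤ toLex e'.poleOrders

/-- The end has type `t`: `t` is the tuple of pole orders of an affinely equivalent reduced end. -/
def HasType (e : MeromorphicEnd) (t : Fin 3 → ℕ) : Prop :=
  ∃ e' : MeromorphicEnd, e.AffinelyEquivalent e' ∧ e'.IsReduced ∧ e'.poleOrders = t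

/-- The order of an end is the last entry of its type. -/
def HasOrder (e : MeromorphicEnd) (n : ℕ) : Prop :=
  ∃ t : Fin 3 → ℕ, e.HasType t ∧ t 2 = n

/-- The end is proper: `f` is a proper map into `ℝ³` on some closed punctured disk about the
puncture. -/
def IsProper (e : MeromorphicEnd) : Prop :=
  ∃ r : ℝ, 0 < r ∧ r < 1 ∧ IsProperMap (fun z : closedPuncturedDisk r => e.toFun z)

/-- The end is injective near the puncture. -/
def IsInjective (e : MeromorphicEnd) : Prop :=
  ∃ r : ℝ, 0 < r ∧ r < 1 ∧ Set.InjOn e.toFun (closedPuncturedDisk r)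

/-- The end is properly embedded: on some closed punctured disk about the puncture, `f` is a
proper injective immersion into `ℝ³`. -/
def IsProperlyEmbedded (e : MeromorphicEnd) : Prop :=
  ∃ r : ℝ, 0 < r ∧ r < 1 ∧
    IsProperMap (fun z : closedPuncturedDisk r => e.toFun z) ∧
    Set.InjOn e.toFun (closedPuncturedDisk r) ∧
    ∀ z ∈ closedPuncturedDisk r, Function.Injective (fderiv ℝ e.toFun z)

end MeromorphicEnd

open Filter Topology

/-! Integrating Laurent expansions, each coordinate of an end of order 3 is `Re (a z⁻² + b z⁻¹ + H
z) + c log |z|` near the puncture, with `H` analytic. The residue `c` is real because the end is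
single-valued. In the coordinate ζ = 1/z the leading part becomes `Re (a ζ² + b ζ)`, and the rest is
Lipschitz near infinity with an arbitrarily small constant (`HasExpansion.exists_lipschitz`). The
geometry is therefore decided by leading coefficients.

An affine map acts on the forms by an invertible real matrix. Reducedness thus means that real
combinations of the forms cannot lower the pole orders, that is, certain leading coefficients are
independent over ℝ. Three complex numbers are dependent over ℝ, which excludes (3,3,3). Two real
residues are dependent, which excludes (1,1,3). The eight listed types remain
(`IsReduced.poleOrders_mem`).

Type (2,2,3): the first two coordinates form a real linear isomorphism in ζ plus a small Lipschitz
term. The end is then bounded below by a multiple of |ζ - ζ'|, which gives injectivity, properness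
and immersion together (`isProperlyEmbedded_of_antilipschitz`).

Types (n,3,3), n ≤ 2: after a linear change the last two coordinates are ζ² plus a Lipschitz term, a
double cover near infinity. The remaining coordinate, compared on the two sheets, changes sign along
a loop, which forces a double point (`exists_ne_sq_add_eq`).

Type (0,0,3): two coordinates are bounded, and the third vanishes somewhere on every large circle in
ζ, so the end is bounded along a sequence tending to the puncture.

For the other three types there are explicit ends. Real coefficients make an end invariant under
conjugation, hence not injective; a suitable imaginary coefficient breaks this symmetry and gives an
embedding. -/

/-! ### Pole orders and Laurent expansions. -/

/-- The order of the pole of a function at `0`; it is `0` if there is no pole. -/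
noncomputable def poleOrder (g : ℂ → ℂ) : ℕ := (-(meromorphicOrderAt g 0).untop₀).toNat

theorem poleOrder_le_iff {g : ℂ → ℂ} {n : ℕ} :
    poleOrder g ≤ n ↔ ((-(n : ℤ) : ℤ) : WithTop ℤ) ≤ meromorphicOrderAt g 0 := by
  unfold poleOrder
  induction h : meromorphicOrderAt g 0 using WithTop.recTopCoe with
  -- A function vanishing near the puncture has order `⊤`, and `untop₀` turns this into pole order
  -- 0, so both sides hold.
  | top => simp
  | coe m =>
    rw [WithTop.untop₀_coe, WithTop.coe_le_coe]
    omega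

theorem poleOrder_congr {g g' : ℂ → ℂ} (h : g =ᶠ[𝓝[≠] 0] g') : poleOrder g = poleOrder g' := by
  rw [poleOrder, poleOrder, meromorphicOrderAt_congr h]

theorem meromorphicOrderAt_inv_pow_mul {h : ℂ → ℂ} (hh : AnalyticAt ℂ h 0) (n : ℕ) :
    meromorphicOrderAt (fun z => (z ^ n)⁻¹ * h z) 0
      = ((-(n : ℤ) : ℤ) : WithTop ℤ) + meromorphicOrderAt h 0 := by
  have h1 : MeromorphicAt (fun z : ℂ => (z ^ n)⁻¹) 0 := by fun_prop
  have h2 : meromorphicOrderAt (fun z : ℂ => (z ^ n)⁻¹) 0 = ((-(n : ℤ) : ℤ) : WithTop ℤ) := by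
    have := meromorphicOrderAt_zpow_id_sub_const (𝕜 := ℂ) (x := 0) (n := -(n : ℤ))
    rw [← this]
    congr 1
    ext z
    simp
  rw [fun_meromorphicOrderAt_mul h1 hh.meromorphicAt, h2]

theorem poleOrder_inv_pow_mul_le {g h : ℂ → ℂ} (hh : AnalyticAt ℂ h 0) {n : ℕ}
    (hg : ∀ᶠ z in 𝓝[≠] 0, g z = (z ^ n)⁻¹ * h z) : poleOrder g ≤ n := by
  rw [poleOrder_congr hg, poleOrder_le_iff, meromorphicOrderAt_inv_pow_mul hh]
  exact le_add_of_nonneg_right hh.meromorphicOrderAt_nonneg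

theorem poleOrder_inv_pow_succ_mul_le_iff {g h : ℂ → ℂ} (hh : AnalyticAt ℂ h 0) {n : ℕ}
    (hg : ∀ᶠ z in 𝓝[≠] 0, g z = (z ^ (n + 1))⁻¹ * h z) : poleOrder g ≤ n ↔ h 0 = 0 := by
  rw [poleOrder_congr hg, poleOrder_le_iff, meromorphicOrderAt_inv_pow_mul hh]
  have h1 : h 0 = 0 ↔ 0 < meromorphicOrderAt h 0 := by
    rw [← tendsto_zero_iff_meromorphicOrderAt_pos hh.meromorphicAt]
    have h2 : Tendsto h (𝓝[≠] 0) (𝓝 (h 0)) := hh.continuousAt.tendsto.mono_left nhdsWithin_le_nhds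
    exact ⟨fun h0 => by rwa [h0] at h2, fun h0 => tendsto_nhds_unique h2 h0⟩
  rw [h1]
  induction meromorphicOrderAt h 0 using WithTop.recTopCoe with
  | top => simp
  | coe m =>
    norm_cast
    omega

/-- `g` has the Laurent expansion `a z⁻³ + b z⁻² + c z⁻¹ + h(z)` at `0`, with `h` analytic. -/
structure HasLaurent (g : ℂ → ℂ) (a b c : ℂ) (h : ℂ → ℂ) : Prop where
  analyticAt : AnalyticAt ℂ h 0
  eventually_eq : ∀ᶠ z in 𝓝[≠] 0, g z = a * (z ^ 3)⁻¹ + b * (z ^ 2)⁻¹ + c * z⁻¹ + h z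

theorem AnalyticAt.exists_eq_add_mul {h : ℂ → ℂ} (hh : AnalyticAt ℂ h 0) :
    ∃ h₁ : ℂ → ℂ, AnalyticAt ℂ h₁ 0 ∧ ∀ z, h z = h 0 + z * h₁ z := by
  obtain ⟨p, hp⟩ := hh
  refine ⟨dslope h 0, ⟨_, hp.has_fpower_series_dslope_fslope⟩, fun z => ?_⟩
  have := sub_smul_dslope h 0 z
  simp only [sub_zero, smul_eq_mul] at this
  rw [this]; ring

/-- `z ^ 3 * g z` extends analytically, and splitting off its first three Taylor coefficients gives
the principal part. -/
theorem exists_hasLaurent {g : ℂ → ℂ} (hg : MeromorphicAt g 0) (h3 : poleOrder g ≤ 3) :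
    ∃ a b c h, HasLaurent g a b c h := by
  have hm : MeromorphicAt (fun z => z ^ 3 * g z) 0 := by fun_prop
  have ho : 0 ≤ meromorphicOrderAt (fun z => z ^ 3 * g z) 0 := by
    rw [fun_meromorphicOrderAt_mul (by fun_prop) hg]
    have h1 := meromorphicOrderAt_pow_id_sub_const (𝕜 := ℂ) (x := 0) (n := 3)
    have h2 : meromorphicOrderAt (fun z : ℂ => z ^ 3) 0 = ((3 : ℤ) : WithTop ℤ) := by
      rw [show ((3 : ℤ) : WithTop ℤ) = ((3 : ℕ) : WithTop ℤ) from rfl, ← h1]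
      congr 1
      ext z
      simp
    rw [h2]
    rw [poleOrder_le_iff] at h3
    revert h3
    induction meromorphicOrderAt g 0 using WithTop.recTopCoe with
    | top => simp
    | coe m =>
      norm_cast
      push_cast
      omega
  obtain ⟨h, hh, he⟩ := (MeromorphicAt.meromorphicOrderAt_nonneg_iff hm).1 ho
  obtain ⟨h₁, hh₁, e₁⟩ := hh.exists_eq_add_mul
  obtain ⟨h₂, hh₂, e₂⟩ := hh₁.exists_eq_add_mul
  obtain ⟨h₃, hh₃, e₃⟩ := hh₂.exists_eq_add_mul
  refine ⟨h 0, h₁ 0, h₂ 0, h₃, hh₃, ?_⟩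
  filter_upwards [he, self_mem_nhdsWithin] with z hz hz0
  have hz0 : z ≠ 0 := hz0
  have : z ^ 3 * g z = h 0 + z * (h₁ 0 + z * (h₂ 0 + z * h₃ z)) := by
    rw [hz, e₁ z, e₂ z, e₃ z]
  field_simp
  linear_combination this

namespace HasLaurent

variable {g h : ℂ → ℂ} {a b c : ℂ}

theorem poleOrder_le_three (H : HasLaurent g a b c h) : poleOrder g ≤ 3 := by
  have := H.analyticAt
  refine poleOrder_inv_pow_mul_le (h := fun z => a + b * z + c * z ^ 2 + z ^ 3 * h z)
    (by fun_prop) ?_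
  filter_upwards [H.eventually_eq, self_mem_nhdsWithin] with z hz hz0
  have hz0 : z ≠ 0 := hz0
  rw [hz]; field_simp

theorem poleOrder_le_two_iff (H : HasLaurent g a b c h) : poleOrder g ≤ 2 ↔ a = 0 := by
  have := H.analyticAt
  rw [poleOrder_inv_pow_succ_mul_le_iff (h := fun z => a + b * z + c * z ^ 2 + z ^ 3 * h z)
    (by fun_prop)]
  · simp
  filter_upwards [H.eventually_eq, self_mem_nhdsWithin] with z hz hz0
  have hz0 : z ≠ 0 := hz0
  rw [hz]; field_simp; ring

theorem poleOrder_le_one_iff (H : HasLaurent g a b c h) : poleOrder g ≤ 1 ↔ a = 0 ∧ b = 0 := by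
  have := H.analyticAt
  by_cases ha : a = 0
  · rw [poleOrder_inv_pow_succ_mul_le_iff (h := fun z => b + c * z + z ^ 2 * h z) (by fun_prop)]
    · simp [ha]
    filter_upwards [H.eventually_eq, self_mem_nhdsWithin] with z hz hz0
    have hz0 : z ≠ 0 := hz0
    rw [hz, ha]; field_simp; ring
  · have := H.poleOrder_le_two_iff
    simp only [ha, iff_false, not_le, false_and] at this ⊢
    omega

theorem poleOrder_le_zero_iff (H : HasLaurent g a b c h) :
    poleOrder g ≤ 0 ↔ a = 0 ∧ b = 0 ∧ c = 0 := by
  have := H.analyticAt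
  by_cases hab : a = 0 ∧ b = 0
  · rw [poleOrder_inv_pow_succ_mul_le_iff (h := fun z => c + z * h z) (by fun_prop)]
    · simp [hab]
    filter_upwards [H.eventually_eq, self_mem_nhdsWithin] with z hz hz0
    have hz0 : z ≠ 0 := hz0
    rw [hz, hab.1, hab.2]; field_simp; ring
  · have := H.poleOrder_le_one_iff
    simp only [hab, iff_false, not_le] at this
    constructor
    · intro _; omega
    · rintro ⟨rfl, rfl, rfl⟩; simp at hab

end HasLaurent

theorem HasLaurent.sum {g h : Fin 3 → ℂ → ℂ} {a b c : Fin 3 → ℂ}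
    (H : ∀ k, HasLaurent (g k) (a k) (b k) (c k) (h k)) (s : Fin 3 → ℝ) :
    HasLaurent (fun z => ∑ k, (s k : ℂ) * g k z) (∑ k, s k * a k) (∑ k, s k * b k)
      (∑ k, s k * c k) (fun z => ∑ k, (s k : ℂ) * h k z) := by
  refine ⟨?_, ?_⟩
  · have := fun k => (H k).analyticAt
    fun_prop
  · filter_upwards [eventually_all.2 fun k => (H k).eventually_eq] with z hz
    simp only [hz, Finset.sum_mul, ← Finset.sum_add_distrib]
    exact Finset.sum_congr rfl fun k _ => by ring

/-! ### Affine equivalence and reduced ends. -/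

theorem isOpen_puncturedDisk : IsOpen puncturedDisk :=
  (isOpen_lt continuous_const continuous_norm).inter (isOpen_lt continuous_norm continuous_const)

theorem puncturedDisk_mem_nhdsNE : puncturedDisk ∈ 𝓝[≠] (0 : ℂ) := by
  filter_upwards [self_mem_nhdsWithin,
    mem_nhdsWithin_of_mem_nhds (Metric.ball_mem_nhds (0 : ℂ) one_pos)] with z hz hz1
  exact ⟨norm_pos_iff.2 hz, by simpa using hz1⟩

theorem closedPuncturedDisk_subset {r : ℝ} (hr : r < 1) :
    closedPuncturedDisk r ⊆ puncturedDisk := fun _ hz => ⟨hz.1, hz.2.trans_lt hr⟩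

/-- The rows indexed by `S` are independent and live in the coordinate subspace indexed by `T`. -/
theorem Matrix.card_le_card_of_apply_eq_zero {ι : Type*} [Fintype ι] [DecidableEq ι]
    {M : Matrix ι ι ℝ} (hM : LinearIndependent ℝ M.row) {S T : Finset ι}
    (h : ∀ i ∈ S, ∀ j ∉ T, M i j = 0) : S.card ≤ T.card := by
  have h1 : LinearIndependent ℝ (fun i : S => fun j : T => M i j) := by
    rw [Fintype.linearIndependent_iff]
    intro g hg
    have h2 := hM.comp (fun i : S => (i : ι)) Subtype.val_injective
    rw [Fintype.linearIndependent_iff] at h2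
    refine h2 g ?_
    ext j
    by_cases hj : j ∈ T
    · have := congrFun hg ⟨j, hj⟩
      simpa [Finset.sum_apply] using this
    · simp only [Finset.sum_apply, Function.comp, Pi.smul_apply, Matrix.row, smul_eq_mul,
        Pi.zero_apply]
      exact Finset.sum_eq_zero fun i _ => by rw [h i i.2 j hj, mul_zero]
  simpa using h1.fintype_card_le_finrank

theorem apply_zero_le_of_toLex_le {a b : Fin 3 → ℕ} (h : toLex a ≤ toLex b) : a 0 ≤ b 0 := by
  by_contra! hlt
  exact not_lt_of_ge h ⟨0, by simp, hlt⟩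

theorem apply_one_le_of_toLex_le {a b : Fin 3 → ℕ} (h : toLex a ≤ toLex b) (h0 : b 0 = a 0) :
    a 1 ≤ b 1 := by
  by_contra! hlt
  refine not_lt_of_ge h ⟨1, fun j hj => ?_, hlt⟩
  obtain rfl : j = 0 := by omega
  exact h0

namespace MeromorphicEnd

/-- The real linear combinations of the forms of an end. -/
def combo (e : MeromorphicEnd) (s : Fin 3 → ℝ) : ℂ → ℂ := fun z => ∑ k, (s k : ℂ) * e.form k z

theorem poleOrders_eq (e : MeromorphicEnd) : e.poleOrders = fun k => poleOrder (e.form k) := rfl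

theorem form_ext {a b : ℂ}
    (h : Complex.reCLM.comp (ContinuousLinearMap.mul ℝ ℂ a)
      = Complex.reCLM.comp (ContinuousLinearMap.mul ℝ ℂ b)) : a = b := by
  have h1 := DFunLike.congr_fun h 1
  have h2 := DFunLike.congr_fun h Complex.I
  simp at h1 h2
  exact Complex.ext h1 h2

theorem hasFDerivAt_combo (e : MeromorphicEnd) (s : Fin 3 → ℝ) (v : ℝ) {z : ℂ}
    (hz : z ∈ puncturedDisk) :
    HasFDerivAt (fun w => ∑ k, s k * e.toFun w k + v)
      (Complex.reCLM.comp (ContinuousLinearMap.mul ℝ ℂ (e.combo s z))) z := by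
  have h := (HasFDerivAt.fun_sum (u := Finset.univ) fun k _ =>
    (e.hasFDerivAt_toFun k z hz).const_mul (s k)).add_const v
  refine h.congr_fderiv ?_
  ext w
  simp only [combo, sum_apply, smul_apply,
    ContinuousLinearMap.comp_apply, ContinuousLinearMap.mul_apply', Complex.reCLM_apply,
    Finset.sum_mul, Complex.re_sum, mul_assoc, Complex.re_ofReal_mul, smul_eq_mul]

theorem differentiableAt_toFun (e : MeromorphicEnd) {z : ℂ} (hz : z ∈ puncturedDisk) :
    DifferentiableAt ℝ e.toFun z :=
  differentiableAt_euclidean.2 fun k => (e.hasFDerivAt_toFun k z hz).differentiableAt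

theorem AffinelyEquivalent.symm {e e' : MeromorphicEnd} (h : e.AffinelyEquivalent e') :
    e'.AffinelyEquivalent e := by
  obtain ⟨A, hA⟩ := h
  exact ⟨A.symm, fun z hz => by rw [hA z hz, A.symm_apply_apply]⟩

theorem AffinelyEquivalent.trans {e e' e'' : MeromorphicEnd} (h : e.AffinelyEquivalent e')
    (h' : e'.AffinelyEquivalent e'') : e.AffinelyEquivalent e'' := by
  obtain ⟨A, hA⟩ := h
  obtain ⟨B, hB⟩ := h'
  exact ⟨A.trans B, fun z hz => by rw [hB z hz, hA z hz]; rfl⟩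

/-- The matrix is that of the linear part. Uniqueness of the derivative carries the relation from
the coordinates over to the forms. -/
theorem AffinelyEquivalent.exists_matrix {e e' : MeromorphicEnd} (h : e.AffinelyEquivalent e') :
    ∃ M : Matrix (Fin 3) (Fin 3) ℝ, IsUnit M ∧
      ∀ k, ∀ z ∈ puncturedDisk, e'.form k z = e.combo (M k) z := by
  obtain ⟨A, hA⟩ := h
  let b := (EuclideanSpace.basisFun (Fin 3) ℝ).toBasis
  let M := LinearMap.toMatrix b b A.linear.toLinearMap
  have hM : ∀ x k, A x k = ∑ j, M k j * x j + A 0 k := by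
    intro x k
    have h1 : A x = A.linear x + A 0 := by
      have := A.map_vadd 0 x
      simpa using this
    have h2 := congrFun (LinearMap.toMatrix_mulVec_repr b b A.linear.toLinearMap x) k
    rw [h1, PiLp.add_apply]
    congr 1
    simp only [Matrix.mulVec, dotProduct, b, OrthonormalBasis.coe_toBasis_repr_apply,
      EuclideanSpace.basisFun_repr] at h2
    exact h2.symm
  refine ⟨M, ?_, fun k z hz => ?_⟩
  · rw [Matrix.isUnit_iff_isUnit_det]
    exact LinearEquiv.isUnit_det A.linear b b
  · have h1 := e'.hasFDerivAt_toFun k z hz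
    have h2 := e.hasFDerivAt_combo (M k) (A 0 k) hz
    refine form_ext (h1.unique (h2.congr_of_eventuallyEq ?_))
    filter_upwards [isOpen_puncturedDisk.mem_nhds hz] with w hw
    rw [hA w hw, hM]

/-- The image of an end under a linear map of `ℝ³`. -/
noncomputable def transform (e : MeromorphicEnd) (M : Matrix (Fin 3) (Fin 3) ℝ) :
    MeromorphicEnd where
  toFun z := Matrix.toEuclideanLin M (e.toFun z)
  form k := e.combo (M k)
  form_holomorphic k := DifferentiableOn.fun_sum fun j _ => (e.form_holomorphic j).const_mul _
  form_meromorphic k := by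
    have := e.form_meromorphic
    unfold combo
    fun_prop
  hasFDerivAt_toFun k z hz := by
    simpa [Matrix.toLpLin_apply, Matrix.mulVec, dotProduct] using e.hasFDerivAt_combo (M k) 0 hz

theorem affinelyEquivalent_transform (e : MeromorphicEnd) {M : Matrix (Fin 3) (Fin 3) ℝ}
    (hM : M.det ≠ 0) : e.AffinelyEquivalent (e.transform M) := by
  have hi : Function.Injective (Matrix.toEuclideanLin M) := by
    rw [← LinearMap.ker_eq_bot, LinearMap.ker_eq_bot']
    intro x hx
    have h1 := Matrix.eq_zero_of_mulVec_eq_zero hM (v := x.ofLp) (by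
      simpa [Matrix.toLpLin_apply] using congrArg WithLp.ofLp hx)
    ext k
    exact congrFun h1 k
  exact ⟨(LinearEquiv.ofInjectiveEndo _ hi).toAffineEquiv, fun z _ => rfl⟩

/-- A sufficient test for minimality, used for all explicit ends: a combination of small pole order
involves no form of larger pole order. At the first index where an equivalent end is smaller, this
would put too many independent rows into a coordinate subspace. -/
theorem isReduced_of_combo {e : MeromorphicEnd} (hm : Monotone e.poleOrders)
    (h : ∀ s k, poleOrder (e.combo s) < e.poleOrders k → s k = 0) : e.IsReduced := by
  refine ⟨hm, fun e' he' => ?_⟩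
  obtain ⟨M, hM, hf⟩ := he'.exists_matrix
  have hn : ∀ k, e'.poleOrders k = poleOrder (e.combo (M k)) := fun k =>
    poleOrder_congr (eventually_of_mem puncturedDisk_mem_nhdsNE (hf k))
  by_contra hlt
  obtain ⟨i, hi, hi'⟩ := not_le.1 hlt
  change ∀ j < i, e'.poleOrders j = e.poleOrders j at hi
  change e'.poleOrders i < e.poleOrders i at hi'
  -- By monotonicity `T` consists of indices below `i`, where the two tuples agree. So the rows in
  -- `insert i T` all have pole order at most `e'.poleOrders i` and are supported in `T`.
  let T : Finset (Fin 3) := {j | e.poleOrders j ≤ e'.poleOrders i}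
  have hiT : i ∉ T := by simpa [T] using hi'
  have hc := Matrix.card_le_card_of_apply_eq_zero (S := insert i T) (T := T)
    (Matrix.linearIndependent_rows_iff_isUnit.2 hM) ?_
  · rw [Finset.card_insert_of_notMem hiT] at hc
    omega
  intro k hk j hj
  refine h (M k) j (lt_of_le_of_lt ?_ (by simpa [T] using hj : e'.poleOrders i < _))
  rw [← hn]
  rcases Finset.mem_insert.1 hk with rfl | hk
  · exact le_rfl
  · have hk : e.poleOrders k ≤ e'.poleOrders i := by simpa [T] using hk
    rwa [hi k (hm.reflect_lt (hk.trans_lt hi'))]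

theorem IsReduced.toLex_le_combo {e : MeromorphicEnd} (he : e.IsReduced)
    {M : Matrix (Fin 3) (Fin 3) ℝ} (hM : M.det ≠ 0) :
    toLex e.poleOrders ≤ toLex fun k => poleOrder (e.combo (M k)) := by
  have h := he.2 _ (e.affinelyEquivalent_transform hM)
  rwa [poleOrders_eq (e.transform M)] at h

/-- A nonzero `s` can be completed to an invertible matrix with first row `s`. -/
theorem IsReduced.poleOrders_zero_le_combo {e : MeromorphicEnd} (he : e.IsReduced)
    {s : Fin 3 → ℝ} (hs : s ≠ 0) : e.poleOrders 0 ≤ poleOrder (e.combo s) := by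
  by_cases h0 : s 0 = 0
  · by_cases h1 : s 1 = 0
    · have h2 : s 2 ≠ 0 := by
        intro h2
        refine hs (funext fun k => ?_)
        fin_cases k <;> assumption
      exact apply_zero_le_of_toLex_le
        (he.toLex_le_combo (M := Matrix.of ![s, ![1, 0, 0], ![0, 1, 0]])
          (by rw [Matrix.det_fin_three]; simpa))
    · exact apply_zero_le_of_toLex_le
        (he.toLex_le_combo (M := Matrix.of ![s, ![1, 0, 0], ![0, 0, 1]])
          (by rw [Matrix.det_fin_three]; simpa))
  · exact apply_zero_le_of_toLex_le
      (he.toLex_le_combo (M := Matrix.of ![s, ![0, 1, 0], ![0, 0, 1]])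
        (by rw [Matrix.det_fin_three]; simpa))

theorem combo_single (e : MeromorphicEnd) : e.combo ![1, 0, 0] = e.form 0 := by
  ext z
  simp [combo, Fin.sum_univ_three]

/-- The first form is kept and `s` becomes the second row; this is possible because `s` is not a
multiple of the first basis vector. -/
theorem IsReduced.poleOrders_one_le_combo {e : MeromorphicEnd} (he : e.IsReduced)
    {s : Fin 3 → ℝ} (hs : s 1 ≠ 0 ∨ s 2 ≠ 0) : e.poleOrders 1 ≤ poleOrder (e.combo s) := by
  rcases hs with hs | hs
  · refine apply_one_le_of_toLex_le (he.toLex_le_combo (M := Matrix.of ![![1, 0, 0], s, ![0, 0, 1]])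
      (by rw [Matrix.det_fin_three]; simpa)) ?_
    exact congrArg poleOrder e.combo_single
  · refine apply_one_le_of_toLex_le (he.toLex_le_combo (M := Matrix.of ![![1, 0, 0], s, ![0, 1, 0]])
      (by rw [Matrix.det_fin_three]; simpa)) ?_
    exact congrArg poleOrder e.combo_single

/-- Two reduced forms of one end are equivalent to each other, so each is lexicographically below
the other. -/
theorem HasType.unique {e : MeromorphicEnd} {t t' : Fin 3 → ℕ} (h : e.HasType t)
    (h' : e.HasType t') : t' = t := by
  obtain ⟨e₁, h₁, hr₁, rfl⟩ := h
  obtain ⟨e₂, h₂, hr₂, rfl⟩ := h'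
  exact toLex.injective
    (le_antisymm (hr₂.2 _ (h₂.symm.trans h₁)) (hr₁.2 _ (h₁.symm.trans h₂)))

theorem AffinelyEquivalent.isProperMap {e e' : MeromorphicEnd} (h : e.AffinelyEquivalent e')
    {r : ℝ} (hr : r < 1) (hp : IsProperMap (fun z : closedPuncturedDisk r => e.toFun z)) :
    IsProperMap (fun z : closedPuncturedDisk r => e'.toFun z) := by
  obtain ⟨A, hA⟩ := h
  have h1 := (AffineEquiv.toContinuousAffineEquiv A).toHomeomorph.isProperMap.comp hp
  have h2 : (fun z : closedPuncturedDisk r => e'.toFun z)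
      = fun z : closedPuncturedDisk r => A (e.toFun z) :=
    funext fun z => hA z (closedPuncturedDisk_subset hr z.2)
  rw [h2]
  exact h1

theorem AffinelyEquivalent.injOn {e e' : MeromorphicEnd} (h : e.AffinelyEquivalent e')
    {r : ℝ} (hr : r < 1) (hi : Set.InjOn e.toFun (closedPuncturedDisk r)) :
    Set.InjOn e'.toFun (closedPuncturedDisk r) := by
  obtain ⟨A, hA⟩ := h
  intro z hz w hw hzw
  rw [hA z (closedPuncturedDisk_subset hr hz), hA w (closedPuncturedDisk_subset hr hw)] at hzw
  exact hi hz hw (A.injective hzw)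

theorem AffinelyEquivalent.fderiv_injective {e e' : MeromorphicEnd}
    (h : e.AffinelyEquivalent e') {z : ℂ} (hz : z ∈ puncturedDisk)
    (hi : Function.Injective (fderiv ℝ e.toFun z)) :
    Function.Injective (fderiv ℝ e'.toFun z) := by
  obtain ⟨A, hA⟩ := h
  have h1 : e'.toFun =ᶠ[𝓝 z]
      fun w => (A.linear.toContinuousLinearEquiv ∘ e.toFun) w + A 0 := by
    filter_upwards [isOpen_puncturedDisk.mem_nhds hz] with w hw
    rw [hA w hw]
    have := A.map_vadd 0 (e.toFun w)
    simpa using this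
  rw [h1.fderiv_eq, fderiv_add_const, ContinuousLinearEquiv.comp_fderiv]
  exact A.linear.injective.comp hi

theorem AffinelyEquivalent.isProper {e e' : MeromorphicEnd} (h : e.AffinelyEquivalent e') :
    e.IsProper → e'.IsProper := fun ⟨r, h0, h1, hp⟩ => ⟨r, h0, h1, h.isProperMap h1 hp⟩

theorem AffinelyEquivalent.isInjective {e e' : MeromorphicEnd} (h : e.AffinelyEquivalent e') :
    e.IsInjective → e'.IsInjective := fun ⟨r, h0, h1, hp⟩ => ⟨r, h0, h1, h.injOn h1 hp⟩

theorem AffinelyEquivalent.isProperlyEmbedded {e e' : MeromorphicEnd}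
    (h : e.AffinelyEquivalent e') : e.IsProperlyEmbedded → e'.IsProperlyEmbedded :=
  fun ⟨r, h0, h1, hp, hi, hd⟩ => ⟨r, h0, h1, h.isProperMap h1 hp, h.injOn h1 hi, fun z hz =>
    h.fderiv_injective (closedPuncturedDisk_subset h1 hz) (hd z hz)⟩

theorem IsProperlyEmbedded.isInjective {e : MeromorphicEnd} :
    e.IsProperlyEmbedded → e.IsInjective := fun ⟨r, h0, h1, _, hi, _⟩ => ⟨r, h0, h1, hi⟩

theorem IsProperlyEmbedded.isProper {e : MeromorphicEnd} :
    e.IsProperlyEmbedded → e.IsProper := fun ⟨r, h0, h1, hp, _, _⟩ => ⟨r, h0, h1, hp⟩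

/-! ### Criteria for properness and immersion. -/

/-- An end that tends to infinity at the puncture is proper. -/
theorem isProperMap_of_tendsto (e : MeromorphicEnd)
    (h : ∀ C : ℝ, ∃ δ > 0, ∀ z ∈ puncturedDisk, ‖z‖ < δ → C < ‖e.toFun z‖) {r : ℝ} (hr : r < 1) :
    IsProperMap (fun z : closedPuncturedDisk r => e.toFun z) := by
  have hcont : Continuous (fun z : closedPuncturedDisk r => e.toFun z) :=
    continuous_iff_continuousAt.2 fun z => ContinuousAt.comp (g := e.toFun)
      (e.differentiableAt_toFun (closedPuncturedDisk_subset hr z.2)).continuousAt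
      continuous_subtype_val.continuousAt
  refine isProperMap_iff_isCompact_preimage.2 ⟨hcont, fun K hK => ?_⟩
  obtain ⟨C, hC⟩ := hK.isBounded.exists_norm_le
  obtain ⟨δ, hδ, hδ'⟩ := h C
  have hs : IsCompact ((Subtype.val : closedPuncturedDisk r → ℂ) ⁻¹'
      (Metric.closedBall 0 r \ Metric.ball 0 δ)) := by
    refine Topology.IsInducing.subtypeVal.isCompact_preimage'
      ((isCompact_closedBall 0 r).diff Metric.isOpen_ball) fun z hz => ?_
    simp only [Set.mem_sdiff, Metric.mem_closedBall, dist_zero_right, Metric.mem_ball,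
      not_lt] at hz
    exact ⟨⟨z, hδ.trans_le hz.2, hz.1⟩, rfl⟩
  refine hs.of_isClosed_subset (hK.isClosed.preimage hcont) fun z hz => ?_
  simp only [Set.mem_preimage, Set.mem_sdiff, Metric.mem_closedBall, dist_zero_right,
    Metric.mem_ball, not_lt]
  refine ⟨z.2.2, ?_⟩
  by_contra! hlt
  exact (hδ' z (closedPuncturedDisk_subset hr z.2) hlt).not_ge (hC _ hz)

/-- An end that is bounded along a sequence tending to the puncture is not proper. -/
theorem not_isProper_of_bounded (e : MeromorphicEnd) (C : ℝ)
    (h : ∀ δ > 0, ∃ z : ℂ, 0 < ‖z‖ ∧ ‖z‖ ≤ δ ∧ ‖e.toFun z‖ ≤ C) : ¬ e.IsProper := by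
  rintro ⟨r, h0, h1, hp⟩
  have hK := (hp.isCompact_preimage (isCompact_closedBall 0 C)).image continuous_subtype_val
  obtain ⟨z₀, hz₀, hz₀C⟩ : ∃ z : ℂ, (0 < ‖z‖ ∧ ‖z‖ ≤ r) ∧ ‖e.toFun z‖ ≤ C := by
    obtain ⟨z, h1, h2, h3⟩ := h r h0
    exact ⟨z, ⟨h1, h2⟩, h3⟩
  -- The compact preimage of the ball has a point `w` nearest to the puncture, but the hypothesis
  -- supplies one of at most half its norm.
  obtain ⟨w, hw, hmin⟩ := hK.exists_isMinOn ⟨z₀, ⟨z₀, hz₀⟩, by simpa using hz₀C, rfl⟩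
    continuous_norm.continuousOn
  obtain ⟨⟨w, hw0⟩, -, rfl⟩ := hw
  obtain ⟨z, hz0, hzδ, hzC⟩ := h (‖w‖ / 2) (half_pos hw0.1)
  have h2 : ‖w‖ ≤ ‖z‖ := hmin ⟨⟨z, hz0, by linarith [hw0.2, hw0.1]⟩, by simpa using hzC, rfl⟩
  linarith [hw0.1]

theorem fderiv_injective_of_form (e : MeromorphicEnd) {z : ℂ} (hz : z ∈ puncturedDisk)
    (h : ∀ v : ℂ, (∀ k, (e.form k z * v).re = 0) → v = 0) :
    Function.Injective (fderiv ℝ e.toFun z) := by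
  rw [injective_iff_map_eq_zero]
  intro v hv
  refine h v fun k => ?_
  have h1 := (EuclideanSpace.proj (𝕜 := ℝ) k).hasFDerivAt.comp z
    (e.differentiableAt_toFun hz).hasFDerivAt
  have h2 := DFunLike.congr_fun (h1.unique (e.hasFDerivAt_toFun k z hz)) v
  simpa [hv] using h2.symm

end MeromorphicEnd

/-! ### Integration at the puncture and Lipschitz control of lower order terms. -/

/-- A real potential on a punctured disk whose differential is `Re (c dz / z)`: its period is zero,
so `c` is real, and it is a multiple of `log |z|` up to a constant. -/
theorem exists_eq_log_of_hasFDerivAt {u : ℂ → ℝ} {c : ℂ} {ρ : ℝ} (hρ : 0 < ρ)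
    (hu : ∀ z : ℂ, 0 < ‖z‖ → ‖z‖ < ρ →
      HasFDerivAt u (Complex.reCLM.comp (ContinuousLinearMap.mul ℝ ℂ (c * z⁻¹))) z) :
    c.im = 0 ∧ ∃ C, ∀ z : ℂ, 0 < ‖z‖ → ‖z‖ < ρ → u z = c.re * Real.log ‖z‖ + C := by
  have hexp : ∀ w : ℂ, w.re < Real.log ρ → 0 < ‖Complex.exp w‖ ∧ ‖Complex.exp w‖ < ρ := by
    intro w hw
    rw [Complex.norm_exp]
    exact ⟨Real.exp_pos _, (Real.lt_log_iff_exp_lt hρ).1 hw⟩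
  -- Pulled back by the exponential to a half plane, the form becomes `Re (c dw)`, so `v` is locally
  -- constant on a connected set.
  let v : ℂ → ℝ := fun w => u (Complex.exp w) - (c * w).re
  have hv : ∀ w : ℂ, w.re < Real.log ρ → HasFDerivAt v (0 : ℂ →L[ℝ] ℝ) w := by
    intro w hw
    have h1 := (hu _ (hexp w hw).1 (hexp w hw).2).comp w
      ((Complex.hasDerivAt_exp w).hasFDerivAt.restrictScalars ℝ)
    have h2 : HasFDerivAt (fun w : ℂ => (c * w).re)
        (Complex.reCLM.comp (ContinuousLinearMap.mul ℝ ℂ c)) w :=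
      (Complex.reCLM.comp (ContinuousLinearMap.mul ℝ ℂ c)).hasFDerivAt
    refine (h1.sub h2).congr_fderiv ?_
    ext x
    have : c * (Complex.exp w)⁻¹ * (x * Complex.exp w) = c * x := by
      field_simp [Complex.exp_ne_zero w]
    simp [this]
  have hopen : IsOpen {w : ℂ | w.re < Real.log ρ} :=
    isOpen_lt Complex.continuous_re continuous_const
  have hconst : ∀ w w' : ℂ, w.re < Real.log ρ → w'.re < Real.log ρ → v w = v w' := by
    intro w w' hw hw'
    exact hopen.is_const_of_fderiv_eq_zero (convex_halfSpace_re_lt _).isPreconnected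
      (fun x hx => (hv x hx).differentiableAt.differentiableWithinAt)
      (fun x hx => (hv x hx).fderiv) hw hw'
  have him : c.im = 0 := by
    -- A turn around the puncture, w ↦ w + 2πi, leaves `u (exp w)` unchanged and alters `Re (c w)`
    -- by -2π Im c.
    let w : ℂ := ((Real.log ρ - 1 : ℝ) : ℂ)
    have hw : w.re < Real.log ρ := by simp [w]
    have := hconst w (w + 2 * Real.pi * Complex.I) hw (by simpa using hw)
    simp only [v, Complex.exp_periodic w, sub_right_inj] at this
    simp [mul_add] at this
    simpa [Real.pi_ne_zero] using this
  refine ⟨him, v ((Real.log ρ - 1 : ℝ) : ℂ), fun z hz0 hz1 => ?_⟩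
  have hz : z ≠ 0 := norm_pos_iff.1 hz0
  have hre : (Complex.log z).re < Real.log ρ := by
    rw [Complex.log_re]
    exact Real.log_lt_log hz0 hz1
  rw [← hconst _ _ hre (by simp)]
  simp [v, Complex.exp_log hz, Complex.mul_re, him, Complex.log_re]

/-- `f` is the real part of `a z⁻² + b z⁻¹ + c log z + H(z)` near `0`, with `H` analytic. -/
structure HasExpansion (f : ℂ → ℝ) (a b : ℂ) (c : ℝ) (H : ℂ → ℂ) : Prop where
  analyticAt : AnalyticAt ℂ H 0
  eventually_eq : ∀ᶠ z in 𝓝[≠] 0,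
    f z = (a * (z ^ 2)⁻¹ + b * z⁻¹ + H z).re + c * Real.log ‖z‖

/-- Subtracting the real part of a primitive of all terms except the residue leaves a potential of
`Re (c dz / z)`, to which `exists_eq_log_of_hasFDerivAt` applies. The factors -2 and -1 come from
differentiating z⁻² and z⁻¹. -/
theorem MeromorphicEnd.exists_hasExpansion (e : MeromorphicEnd) {k : Fin 3}
    (hk : e.poleOrders k ≤ 3) :
    ∃ (a b : ℂ) (c : ℝ) (h H : ℂ → ℂ), HasLaurent (e.form k) (-2 * a) (-b) c h ∧
      HasExpansion (fun z => e.toFun z k) a b c H := by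
  obtain ⟨g₀, g₁, g₂, h, hL⟩ := exists_hasLaurent (e.form_meromorphic k) hk
  obtain ⟨ρ₁, hρ₁, han⟩ := hL.analyticAt.exists_ball_analyticOnNhd
  obtain ⟨ρ₂, hρ₂, heq⟩ := Metric.mem_nhdsWithin_iff.1 hL.eventually_eq
  obtain ⟨ρ, hρ, hρle⟩ : ∃ ρ : ℝ, 0 < ρ ∧ ρ ≤ ρ₁ ∧ ρ ≤ ρ₂ ∧ ρ ≤ 1 :=
    ⟨min ρ₁ (min ρ₂ 1), by positivity, min_le_left _ _,
      (min_le_right _ _).trans (min_le_left _ _), (min_le_right _ _).trans (min_le_right _ _)⟩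
  obtain ⟨H, hH⟩ := DifferentiableOn.isExactOn_ball (f := h) (c := 0) (r := ρ)
    (han.differentiableOn.mono (Metric.ball_subset_ball hρle.1))
  have hHan : AnalyticAt ℂ H 0 :=
    DifferentiableOn.analyticAt (s := Metric.ball 0 ρ)
      (fun z hz => (hH z hz).differentiableAt.differentiableWithinAt) (Metric.ball_mem_nhds _ hρ)
  let P : ℂ → ℂ := fun z => -g₀ / 2 * (z ^ 2)⁻¹ + -g₁ * z⁻¹ + H z
  have hP : ∀ z : ℂ, 0 < ‖z‖ → ‖z‖ < ρ →
      HasDerivAt P (g₀ * (z ^ 3)⁻¹ + g₁ * (z ^ 2)⁻¹ + h z) z := by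
    intro z hz0 hz1
    have hz : z ≠ 0 := norm_pos_iff.1 hz0
    have h1 := ((hasDerivAt_pow 2 z).fun_inv (pow_ne_zero 2 hz)).const_mul (-g₀ / 2)
    have h2 := (hasDerivAt_inv hz).const_mul (-g₁)
    refine ((h1.add h2).add (hH z (by simpa using hz1))).congr_deriv ?_
    field_simp
    push_cast
    ring
  obtain ⟨him, C, hC⟩ := exists_eq_log_of_hasFDerivAt (u := fun z => e.toFun z k - (P z).re)
    (c := g₂) hρ (by
      intro z hz0 hz1
      have h1 := e.hasFDerivAt_toFun k z ⟨hz0, hz1.trans_le hρle.2.2⟩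
      have h2 := Complex.reCLM.hasFDerivAt.comp z
        ((hP z hz0 hz1).hasFDerivAt.restrictScalars ℝ)
      refine (h1.sub h2).congr_fderiv ?_
      have h3 : e.form k z = _ := heq ⟨by simpa using hz1.trans_le hρle.2.1, norm_pos_iff.1 hz0⟩
      rw [h3]
      ext x
      simp
      ring)
  have hg₂ : g₂ = (g₂.re : ℂ) := Complex.ext (by simp) (by simp [him])
  refine ⟨-g₀ / 2, -g₁, g₂.re, h, fun z => H z + C, ?_, by fun_prop, ?_⟩
  · rw [← hg₂]
    convert hL using 1 <;> ring
  · filter_upwards [self_mem_nhdsWithin,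
      mem_nhdsWithin_of_mem_nhds (Metric.ball_mem_nhds (0 : ℂ) hρ)] with z hz hz1
    have := hC z (norm_pos_iff.2 hz) (by simpa using hz1)
    simp only [P, Complex.add_re, Complex.ofReal_re] at this ⊢
    linarith

theorem abs_log_sub_log_le {R x y : ℝ} (hR : 0 < R) (hx : R ≤ x) (hy : R ≤ y) :
    |Real.log x - Real.log y| ≤ |x - y| / R := by
  wlog h : y ≤ x generalizing x y
  · rw [abs_sub_comm, abs_sub_comm x]
    exact this hy hx (le_of_not_ge h)
  have hy0 := hR.trans_le hy
  have hx0 := hR.trans_le hx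
  rw [abs_of_nonneg (sub_nonneg.2 (Real.log_le_log hy0 h)), abs_of_nonneg (sub_nonneg.2 h),
    ← Real.log_div hx0.ne' hy0.ne']
  calc Real.log (x / y) ≤ x / y - 1 := Real.log_le_sub_one_of_pos (by positivity)
    _ = (x - y) / y := by field_simp
    _ ≤ (x - y) / R := div_le_div_of_nonneg_left (sub_nonneg.2 h) hR hy

theorem norm_inv_sub_inv_le {R : ℝ} (hR : 1 ≤ R) {z w : ℂ} (hz : R ≤ ‖z‖) (hw : R ≤ ‖w‖) :
    ‖z⁻¹ - w⁻¹‖ ≤ ‖z - w‖ / R := by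
  have hz0 : 0 < ‖z‖ := by linarith
  have hw0 : 0 < ‖w‖ := by linarith
  rw [inv_sub_inv (norm_pos_iff.1 hz0) (norm_pos_iff.1 hw0), norm_div, norm_mul, norm_sub_rev]
  refine div_le_div_of_nonneg_left (norm_nonneg _) (by linarith) ?_
  nlinarith

namespace HasExpansion

variable {f : ℂ → ℝ} {a b : ℂ} {c : ℝ} {H : ℂ → ℂ}

/-- In the coordinate `ζ = 1 / z`, the sum of the logarithmic and the regular part is Lipschitz
near infinity with an arbitrarily small constant. -/
theorem exists_lipschitz (hf : HasExpansion f a b c H) {ε : ℝ} (hε : 0 < ε) :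
    ∃ R : ℝ, 1 < R ∧ ∀ z w : ℂ, R ≤ ‖z‖ → R ≤ ‖w‖ →
      |(f z⁻¹ - (a * z ^ 2 + b * z).re) - (f w⁻¹ - (a * w ^ 2 + b * w).re)| ≤ ε * ‖z - w‖ := by
  obtain ⟨K, t, ht, hK⟩ := ContDiffAt.exists_lipschitzOnWith
    (hf.analyticAt.contDiffAt (n := 1))
  obtain ⟨δ₁, hδ₁, h₁⟩ := Metric.mem_nhds_iff.1 ht
  obtain ⟨δ₂, hδ₂, h₂⟩ := Metric.mem_nhdsWithin_iff.1 hf.eventually_eq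
  -- Beyond `R` the logarithm is 1/R-Lipschitz and so is inversion, so the lower order terms have
  -- constant at most (|c| + K)/R < ε.
  obtain ⟨R, hR⟩ : ∃ R : ℝ, 1 < R ∧ δ₁⁻¹ < R ∧ δ₂⁻¹ < R ∧ (|c| + K) / ε < R := by
    have := (((eventually_gt_atTop (1 : ℝ)).and (eventually_gt_atTop δ₁⁻¹)).and
      ((eventually_gt_atTop δ₂⁻¹).and (eventually_gt_atTop ((|c| + K) / ε)))).exists
    obtain ⟨R, hR⟩ := this
    exact ⟨R, hR.1.1, hR.1.2, hR.2.1, hR.2.2⟩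
  obtain ⟨hR1, hRδ₁, hRδ₂, hRε⟩ := hR
  have hR0 : 0 < R := by linarith
  have hin : ∀ z : ℂ, R ≤ ‖z‖ → z⁻¹ ∈ t ∧
      f z⁻¹ = (a * z ^ 2 + b * z).re + (H z⁻¹).re - c * Real.log ‖z‖ := by
    intro z hz
    have hz0 : 0 < ‖z‖ := by linarith
    have hzne : z ≠ 0 := norm_pos_iff.1 hz0
    refine ⟨h₁ ?_, ?_⟩
    · rw [Metric.mem_ball, dist_zero_right, norm_inv]
      exact inv_lt_of_inv_lt₀ hδ₁ (hRδ₁.trans_le hz)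
    · have := h₂ (show z⁻¹ ∈ Metric.ball 0 δ₂ ∩ {0}ᶜ from ⟨by
        rw [Metric.mem_ball, dist_zero_right, norm_inv]
        exact inv_lt_of_inv_lt₀ hδ₂ (hRδ₂.trans_le hz), inv_ne_zero hzne⟩)
      simp only [Set.mem_ofPred_eq] at this
      rw [this, norm_inv, Real.log_inv, inv_pow, inv_inv, inv_inv, Complex.add_re]
      ring
  refine ⟨R, hR1, fun z w hz hw => ?_⟩
  rw [(hin z hz).2, (hin w hw).2]
  have e1 : |(H z⁻¹).re - (H w⁻¹).re| ≤ K * (‖z - w‖ / R) := by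
    rw [← Complex.sub_re]
    refine (Complex.abs_re_le_norm _).trans ((hK.norm_sub_le (hin z hz).1 (hin w hw).1).trans ?_)
    exact mul_le_mul_of_nonneg_left (norm_inv_sub_inv_le hR1.le hz hw) K.2
  have e2 : |c * Real.log ‖z‖ - c * Real.log ‖w‖| ≤ |c| * (‖z - w‖ / R) := by
    rw [← mul_sub, abs_mul]
    refine mul_le_mul_of_nonneg_left ((abs_log_sub_log_le hR0 hz hw).trans ?_) (abs_nonneg _)
    exact div_le_div_of_nonneg_right (abs_norm_sub_norm_le z w) hR0.le
  have e3 : (|c| + K) * (‖z - w‖ / R) ≤ ε * ‖z - w‖ := by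
    rw [div_lt_iff₀ hε] at hRε
    rw [mul_div_assoc', div_le_iff₀ hR0]
    nlinarith [norm_nonneg (z - w)]
  calc _ = |((H z⁻¹).re - (H w⁻¹).re) - (c * Real.log ‖z‖ - c * Real.log ‖w‖)| := by ring_nf
    _ ≤ _ := abs_sub _ _
    _ ≤ _ := by linarith

theorem exists_bound (hf : HasExpansion f 0 0 0 H) :
    ∃ C δ : ℝ, 0 < δ ∧ ∀ z : ℂ, 0 < ‖z‖ → ‖z‖ < δ → |f z| ≤ C := by
  have h1 : ∀ᶠ z in 𝓝[≠] (0 : ℂ), ‖H z‖ ≤ ‖H 0‖ + 1 :=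
    (hf.analyticAt.continuousAt.norm.eventually_le_const (lt_add_one _)).filter_mono
      nhdsWithin_le_nhds
  obtain ⟨δ, hδ, h⟩ := Metric.mem_nhdsWithin_iff.1 (hf.eventually_eq.and h1)
  refine ⟨‖H 0‖ + 1, δ, hδ, fun z hz0 hz1 => ?_⟩
  obtain ⟨h2, h3⟩ := h ⟨by simpa using hz1, norm_pos_iff.1 hz0⟩
  rw [h2]
  simpa using (Complex.abs_re_le_norm _).trans h3

end HasExpansion

/-! ### Linear normalization and the perturbed double cover. -/

theorem exists_continuousLinearEquiv_re_mul {a b : ℂ}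
    (hab : ∀ s t : ℝ, (s : ℂ) * a + t * b = 0 → s = 0 ∧ t = 0) :
    ∃ Λ : ℂ ≃L[ℝ] ℂ, ∀ w, Λ w = (((a * w).re : ℝ) : ℂ) + (((b * w).re : ℝ) : ℂ) * Complex.I := by
  let Λ₀ : ℂ →ₗ[ℝ] ℂ :=
    { toFun := fun w => (((a * w).re : ℝ) : ℂ) + (((b * w).re : ℝ) : ℂ) * Complex.I
      map_add' := fun x y => by simp only [mul_add, Complex.add_re]; push_cast; ring
      map_smul' := fun s x => by apply Complex.ext <;> simp <;> ring }
  have hi : Function.Injective Λ₀ := by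
    rw [← LinearMap.ker_eq_bot, LinearMap.ker_eq_bot']
    intro w hw
    change (((a * w).re : ℝ) : ℂ) + (((b * w).re : ℝ) : ℂ) * Complex.I = 0 at hw
    have h1 : (a * w).re = 0 := by simpa using congrArg Complex.re hw
    have h2 : (b * w).re = 0 := by simpa using congrArg Complex.im hw
    by_contra hw0
    -- If `a * w` and `b * w` are both imaginary, then `a` and `b` are real multiples of one complex
    -- number; this is the resulting relation.
    have h3 : (((b * w).im : ℝ) : ℂ) * a + ((-(a * w).im : ℝ) : ℂ) * b = 0 := by
      have e1 : a * w = ((a * w).im : ℂ) * Complex.I := Complex.ext (by simp [h1]) (by simp)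
      have e2 : b * w = ((b * w).im : ℂ) * Complex.I := Complex.ext (by simp [h2]) (by simp)
      generalize (a * w).im = x at *
      generalize (b * w).im = y at *
      apply mul_right_cancel₀ hw0
      push_cast
      linear_combination (y : ℂ) * e1 - x * e2
    have h4 := (hab _ _ h3).2
    have h5 : a * w = 0 := Complex.ext (by simp [h1]) (neg_eq_zero.1 h4)
    have h6 : a = 0 := (mul_eq_zero.1 h5).resolve_right hw0
    simpa using (hab 1 0 (by simp [h6])).1
  exact ⟨(LinearEquiv.ofInjectiveEndo Λ₀ hi).toContinuousLinearEquiv, fun w => rfl⟩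

/-- A Lipschitz perturbation of `ζ²` is a two-fold cover near infinity, so every real continuous
function agrees at two different points of a fibre. -/
theorem exists_ne_sq_add_eq {E : ℂ → ℂ} {K R₀ R : ℝ} (hK : 0 ≤ K)
    (hE : ∀ z w, R₀ ≤ ‖z‖ → R₀ ≤ ‖w‖ → ‖E z - E w‖ ≤ K * ‖z - w‖) {φ : ℂ → ℝ}
    (hφ : ContinuousOn φ {z | R₀ ≤ ‖z‖}) (hR : 0 < R) (hRR : R₀ ≤ R) :
    ∃ z w, z ≠ w ∧ R ≤ ‖z‖ ∧ R ≤ ‖w‖ ∧ z ^ 2 + E z = w ^ 2 + E w ∧ φ z = φ w := by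
  obtain ⟨C, hC0, hC⟩ : ∃ C, 0 ≤ C ∧ ∀ z, R₀ ≤ ‖z‖ → ‖E z‖ ≤ K * ‖z‖ + C := by
    refine ⟨‖E R‖ + K * R, by positivity, fun z hz => ?_⟩
    have hRn : ‖(R : ℂ)‖ = R := by simp [abs_of_pos hR]
    have h1 := hE z R hz (by rwa [hRn])
    have h2 : ‖z - R‖ ≤ ‖z‖ + R := (norm_sub_le _ _).trans_eq (by rw [hRn])
    have h3 : ‖E z‖ ≤ ‖E z - E R‖ + ‖E R‖ := by simpa using norm_add_le (E z - E R) (E R)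
    nlinarith
  set M := K + 1 with hM
  -- The summands make three estimates work on the circle |η| = N: the ball of radius `M` is mapped
  -- to itself (`M ^ 2 + K * M + C`), the map contracts by 1/2 (`2 * M + K`), and `η + u` stays
  -- beyond `R`.
  set N := R + M ^ 2 + K * M + C + 2 * M + K with hN
  have hM0 : 0 < M := by positivity
  have hNM : R + 2 * M + K ≤ N := by nlinarith [mul_nonneg hK hM0.le]
  have hN0 : 0 < N := by linarith
  have hfar : ∀ η u : ℂ, ‖η‖ = N → ‖u‖ ≤ M → R ≤ ‖η + u‖ := by
    intro η u hη hu
    have := norm_sub_le_norm_add η u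
    linarith
  -- This equation says that ζ = η + u satisfies ζ² + E(ζ) = η². It is solved as a fixed point of
  -- `Φ`.
  have hsolve : ∀ η : ℂ, ‖η‖ = N →
      ∃ u : ℂ, ‖u‖ ≤ M ∧ 2 * η * u + u ^ 2 + E (η + u) = 0 := by
    intro η hη
    have hη0 : η ≠ 0 := norm_pos_iff.1 (hη ▸ hN0)
    have hn : ‖2 * η‖ = 2 * N := by rw [norm_mul, hη]; simp
    let Φ : ℂ → ℂ := fun u => -(u ^ 2 + E (η + u)) / (2 * η)
    have hmaps : Set.MapsTo Φ (Metric.closedBall 0 M) (Metric.closedBall 0 M) := by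
      intro u hu
      rw [mem_closedBall_zero_iff] at hu ⊢
      have h1 := hC _ (hRR.trans (hfar η u hη hu))
      have h2 : ‖η + u‖ ≤ N + M := (norm_add_le _ _).trans (by linarith)
      have h3 : ‖u ^ 2 + E (η + u)‖ ≤ M ^ 2 + (K * (N + M) + C) := by
        refine (norm_add_le _ _).trans (add_le_add ?_ (h1.trans ?_))
        · rw [norm_pow]; gcongr
        · gcongr
      rw [norm_div, norm_neg, hn, div_le_iff₀ (by positivity)]
      nlinarith
    have hcontr : ContractingWith (1 / 2) (hmaps.restrict Φ _ _) := by
      refine ⟨by norm_num, LipschitzWith.of_dist_le_mul fun u v => ?_⟩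
      obtain ⟨u, hu⟩ := u
      obtain ⟨v, hv⟩ := v
      rw [Subtype.dist_eq, Subtype.dist_eq, dist_eq_norm, dist_eq_norm]
      simp only [Set.MapsTo.val_restrict_apply]
      rw [mem_closedBall_zero_iff] at hu hv
      have h1 : Φ u - Φ v = -((u - v) * (u + v) + (E (η + u) - E (η + v))) / (2 * η) := by
        simp only [Φ]; ring
      have h2 := hE _ _ (hRR.trans (hfar η u hη hu)) (hRR.trans (hfar η v hη hv))
      rw [add_sub_add_left_eq_sub] at h2
      have h3 : ‖(u - v) * (u + v) + (E (η + u) - E (η + v))‖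
          ≤ ‖u - v‖ * (2 * M) + K * ‖u - v‖ := by
        refine (norm_add_le _ _).trans (add_le_add ?_ h2)
        rw [norm_mul]
        gcongr
        exact (norm_add_le _ _).trans (by linarith)
      rw [h1, norm_div, norm_neg, hn, div_le_iff₀ (by positivity)]
      norm_num
      nlinarith [norm_nonneg (u - v)]
    obtain ⟨u, hu, hfix, -⟩ := hcontr.exists_fixedPoint' Metric.isClosed_closedBall.isComplete
      hmaps (Metric.mem_closedBall_self hM0.le) (edist_ne_top _ _)
    refine ⟨u, mem_closedBall_zero_iff.1 hu, ?_⟩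
    have h1 : -(u ^ 2 + E (η + u)) / (2 * η) = u := hfix
    rw [div_eq_iff (by simpa using hη0)] at h1
    linear_combination -h1
  choose! U hUM hU using hsolve
  -- Subtracting the equations at η and η' makes the solution Lipschitz, hence continuous, along the
  -- circle.
  have hlip : ∀ η η' : ℂ, ‖η‖ = N → ‖η'‖ = N → ‖U η - U η'‖ ≤ ‖η - η'‖ := by
    intro η η' hη hη'
    have h1 := hE _ _ (hRR.trans (hfar η _ hη (hUM η hη))) (hRR.trans (hfar η' _ hη' (hUM η' hη')))
    have h2 : ‖(η + U η) - (η' + U η')‖ ≤ ‖η - η'‖ + ‖U η - U η'‖ := by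
      rw [add_sub_add_comm]; exact norm_add_le _ _
    have h3 : 2 * η * (U η - U η') = -(2 * (η - η') * U η' + (U η - U η') * (U η + U η')
        + (E (η + U η) - E (η' + U η'))) := by
      linear_combination hU η hη - hU η' hη'
    have h4 : 2 * N * ‖U η - U η'‖ ≤ 2 * ‖η - η'‖ * M + ‖U η - U η'‖ * (2 * M)
        + K * (‖η - η'‖ + ‖U η - U η'‖) := by
      calc 2 * N * ‖U η - U η'‖ = ‖2 * η * (U η - U η')‖ := by rw [norm_mul, norm_mul, hη]; simp
        _ ≤ ‖2 * (η - η') * U η'‖ + ‖(U η - U η') * (U η + U η')‖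
            + ‖E (η + U η) - E (η' + U η')‖ := by
          rw [h3, norm_neg]; exact norm_add₃_le
        _ ≤ _ := by
          refine add_le_add (add_le_add ?_ ?_) (h1.trans (mul_le_mul_of_nonneg_left h2 hK))
          · rw [norm_mul, norm_mul]
            simp only [Complex.norm_ofNat]
            gcongr
            exact hUM η' hη'
          · rw [norm_mul]
            gcongr
            exact (norm_add_le _ _).trans (by linarith [hUM η hη, hUM η' hη'])
    have h5 : (2 * M + K) * ‖U η - U η'‖ ≤ (2 * M + K) * ‖η - η'‖ := by
      nlinarith [norm_nonneg (U η - U η')]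
    exact le_of_mul_le_mul_left h5 (by positivity)
  have hUc : ContinuousOn U {η | ‖η‖ = N} :=
    (LipschitzOnWith.of_dist_le_mul (K := 1) fun x hx y hy => by
      simpa [dist_eq_norm] using hlip x y hx hy).continuousOn
  have hTc : ContinuousOn (fun η => φ (η + U η)) {η | ‖η‖ = N} :=
    hφ.comp (continuousOn_id.add hUc) fun η hη => hRR.trans (hfar η _ hη (hUM η hη))
  let γ : ℝ → ℂ := fun t => N * Complex.exp (t * Complex.I)
  have hγ : Continuous γ := by fun_prop
  have hγN : ∀ t, ‖γ t‖ = N := fun t => by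
    simp [γ, Complex.norm_exp_ofReal_mul_I, abs_of_pos hN0]
  have hγN' : ∀ t, ‖-γ t‖ = N := fun t => by rw [norm_neg, hγN]
  -- The solutions over η and -η lie in the same fibre, over η². Their difference in φ changes sign
  -- under η ↦ -η, so it vanishes somewhere on a half circle.
  let g : ℝ → ℝ := fun t => φ (γ t + U (γ t)) - φ (-γ t + U (-γ t))
  have hg : Continuous g :=
    (hTc.comp_continuous hγ hγN).sub (hTc.comp_continuous hγ.neg hγN')
  have hgπ : g Real.pi = -g 0 := by
    have : γ Real.pi = -γ 0 := by simp [γ, Complex.exp_pi_mul_I]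
    simp [g, this]
  obtain ⟨t, ht⟩ : (0 : ℝ) ∈ Set.range g := by
    rcases le_total (g 0) 0 with h0 | h0
    · exact mem_range_of_exists_le_of_exists_ge hg ⟨0, h0⟩ ⟨Real.pi, by linarith⟩
    · exact mem_range_of_exists_le_of_exists_ge hg ⟨Real.pi, by linarith⟩ ⟨0, h0⟩
  refine ⟨γ t + U (γ t), -γ t + U (-γ t), fun heq => ?_, hfar _ _ (hγN t) (hUM _ (hγN t)),
    hfar _ _ (hγN' t) (hUM _ (hγN' t)), ?_, sub_eq_zero.1 ht⟩
  · have h1 : 2 * γ t = U (-γ t) - U (γ t) := by linear_combination heq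
    have h2 := norm_sub_le (U (-γ t)) (U (γ t))
    rw [← h1, norm_mul, hγN] at h2
    simp only [Complex.norm_ofNat] at h2
    linarith [hUM _ (hγN t), hUM _ (hγN' t)]
  · linear_combination hU _ (hγN t) - hU _ (hγN' t)

/-! ### Geometric consequences of the expansions. -/

namespace MeromorphicEnd

theorem norm_le_add_add (x : EuclideanSpace ℝ (Fin 3)) : ‖x‖ ≤ |x 0| + |x 1| + |x 2| := by
  refine abs_le_of_sq_le_sq' ?_ (by positivity) |>.2
  rw [EuclideanSpace.real_norm_sq_eq, Fin.sum_univ_three]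
  nlinarith [sq_abs (x 0), sq_abs (x 1), sq_abs (x 2), abs_nonneg (x 0), abs_nonneg (x 1),
    abs_nonneg (x 2), mul_nonneg (abs_nonneg (x 0)) (abs_nonneg (x 1)),
    mul_nonneg (abs_nonneg (x 0)) (abs_nonneg (x 2)),
    mul_nonneg (abs_nonneg (x 1)) (abs_nonneg (x 2))]

theorem abs_apply_sub_le (x y : EuclideanSpace ℝ (Fin 3)) (k : Fin 3) : |x k - y k| ≤ ‖x - y‖ :=
  PiLp.norm_apply_le (x - y) k

theorem continuousOn_toFun_inv (e : MeromorphicEnd) (k : Fin 3) {R : ℝ} (hR : 1 < R) :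
    ContinuousOn (fun z => e.toFun z⁻¹ k) {z | R ≤ ‖z‖} := by
  intro z hz
  have hz0 : 0 < ‖z‖ := by linarith [show R ≤ ‖z‖ from hz]
  refine ContinuousAt.continuousWithinAt ?_
  refine ContinuousAt.comp (g := fun z => e.toFun z k) ?_
    (continuousAt_inv₀ (norm_pos_iff.1 hz0))
  refine (e.hasFDerivAt_toFun k _ ⟨?_, ?_⟩).continuousAt
  · rw [norm_inv]; positivity
  · rw [norm_inv]; exact inv_lt_one_of_one_lt₀ (hR.trans_le hz)

/-- If two coordinates have poles of order 3 with independent leading coefficients, the end is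
not injective. -/
theorem not_isInjective_of_hasExpansion (e : MeromorphicEnd) {a₁ a₂ b₁ b₂ : ℂ} {c₁ c₂ : ℝ}
    {H₁ H₂ : ℂ → ℂ} (h₁ : HasExpansion (fun z => e.toFun z 1) a₁ b₁ c₁ H₁)
    (h₂ : HasExpansion (fun z => e.toFun z 2) a₂ b₂ c₂ H₂)
    (ha : ∀ s t : ℝ, (s : ℂ) * a₁ + t * a₂ = 0 → s = 0 ∧ t = 0) : ¬ e.IsInjective := by
  rintro ⟨r, hr0, hr1, hinj⟩
  obtain ⟨Λ, hΛ⟩ := exists_continuousLinearEquiv_re_mul ha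
  obtain ⟨R₁, hR₁, hL₁⟩ := h₁.exists_lipschitz one_pos
  obtain ⟨R₂, hR₂, hL₂⟩ := h₂.exists_lipschitz one_pos
  have hR0 : 1 < max R₁ R₂ := hR₁.trans_le (le_max_left _ _)
  let f : ℂ → ℂ := fun z => (e.toFun z⁻¹ 1 : ℂ) + (e.toFun z⁻¹ 2 : ℂ) * Complex.I
  -- The linear term `b * z` only enlarges the Lipschitz constant, so it can be counted as part of
  -- the perturbation of ζ².
  have hlin : ∀ (g : ℂ → ℝ) (a b z w : ℂ),
      |(g z⁻¹ - (a * z ^ 2 + b * z).re) - (g w⁻¹ - (a * w ^ 2 + b * w).re)| ≤ 1 * ‖z - w‖ →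
      |(g z⁻¹ - (a * z ^ 2).re) - (g w⁻¹ - (a * w ^ 2).re)| ≤ (1 + ‖b‖) * ‖z - w‖ := by
    intro g a b z w h
    have h1 : |(b * (z - w)).re| ≤ ‖b‖ * ‖z - w‖ :=
      (Complex.abs_re_le_norm _).trans_eq (norm_mul _ _)
    calc _ = |((g z⁻¹ - (a * z ^ 2 + b * z).re) - (g w⁻¹ - (a * w ^ 2 + b * w).re))
          + (b * (z - w)).re| := by
          congr 1
          rw [mul_sub, Complex.sub_re, Complex.add_re, Complex.add_re]; ring
      _ ≤ _ := (abs_add_le _ _).trans (by linarith)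
  -- With this `E`, ζ² + E(ζ) is `Λ.symm (f ζ)`, so equal values mean that coordinates 1 and 2
  -- agree; coordinate 0 plays the role of φ.
  obtain ⟨z, w, hzw, hz, hw, heq, h0⟩ := exists_ne_sq_add_eq
    (E := fun z => Λ.symm (f z) - z ^ 2)
    (K := ‖(Λ.symm : ℂ →L[ℝ] ℂ)‖ * ((1 + ‖b₁‖) + (1 + ‖b₂‖))) (R₀ := max R₁ R₂)
    (R := max (max R₁ R₂) r⁻¹) (by positivity) (by
      intro z w hz hw
      have e1 := hlin (fun z => e.toFun z 1) _ _ _ _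
        (hL₁ z w ((le_max_left _ _).trans hz) ((le_max_left _ _).trans hw))
      have e2 := hlin (fun z => e.toFun z 2) _ _ _ _
        (hL₂ z w ((le_max_right _ _).trans hz) ((le_max_right _ _).trans hw))
      have e3 : Λ.symm (f z) - z ^ 2 - (Λ.symm (f w) - w ^ 2)
          = Λ.symm (f z - Λ (z ^ 2) - (f w - Λ (w ^ 2))) := by simp
      rw [e3, mul_assoc]
      refine ((Λ.symm : ℂ →L[ℝ] ℂ).le_opNorm _).trans
        (mul_le_mul_of_nonneg_left ?_ (norm_nonneg _))
      refine (Complex.norm_le_abs_re_add_abs_im _).trans ?_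
      rw [add_mul]
      have e4 : (f z - Λ (z ^ 2) - (f w - Λ (w ^ 2))).re = (e.toFun z⁻¹ 1 - (a₁ * z ^ 2).re)
          - (e.toFun w⁻¹ 1 - (a₁ * w ^ 2).re) := by
        simp [f, hΛ, -Complex.mul_re, Complex.re_ofReal_mul]
      have e5 : (f z - Λ (z ^ 2) - (f w - Λ (w ^ 2))).im = (e.toFun z⁻¹ 2 - (a₂ * z ^ 2).re)
          - (e.toFun w⁻¹ 2 - (a₂ * w ^ 2).re) := by
        simp [f, hΛ, -Complex.mul_re]
      rw [e4, e5]
      exact add_le_add e1 e2)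
    (e.continuousOn_toFun_inv 0 hR0) (by positivity) (le_max_left _ _)
  have hmem : ∀ z : ℂ, max (max R₁ R₂) r⁻¹ ≤ ‖z‖ → z⁻¹ ∈ closedPuncturedDisk r := by
    intro z hz
    have : 0 < ‖z‖ := by linarith [(le_max_left _ _).trans hz]
    refine ⟨by rw [norm_inv]; positivity, ?_⟩
    rw [norm_inv]
    exact inv_le_of_inv_le₀ hr0 ((le_max_right _ _).trans hz)
  have hf : f z = f w := by
    simp only [add_sub_cancel] at heq
    exact Λ.symm.injective heq
  refine hzw (inv_injective (hinj (hmem z hz) (hmem w hw) ?_))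
  ext k
  fin_cases k
  · exact h0
  · simpa [f] using congrArg Complex.re hf
  · simpa [f] using congrArg Complex.im hf

/-- If two coordinates are bounded and the third has a pole of order 3, the end is not proper. -/
theorem not_isProper_of_hasExpansion (e : MeromorphicEnd) {a b : ℂ} {c : ℝ}
    {H₀ H₁ H₂ : ℂ → ℂ} (h₀ : HasExpansion (fun z => e.toFun z 0) 0 0 0 H₀)
    (h₁ : HasExpansion (fun z => e.toFun z 1) 0 0 0 H₁)
    (h₂ : HasExpansion (fun z => e.toFun z 2) a b c H₂) (ha : a ≠ 0) : ¬ e.IsProper := by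
  obtain ⟨C₀, δ₀, hδ₀, hC₀⟩ := h₀.exists_bound
  obtain ⟨C₁, δ₁, hδ₁, hC₁⟩ := h₁.exists_bound
  obtain ⟨R, hR, hL⟩ := h₂.exists_lipschitz one_pos
  refine e.not_isProper_of_bounded (C₀ + C₁) fun δ hδ => ?_
  set B := |e.toFun (R : ℂ)⁻¹ 2 - (a * R ^ 2 + b * R).re| + R with hB
  have hR0 : 0 < R := by linarith
  have hbound : ∀ z : ℂ, R ≤ ‖z‖ →
      |e.toFun z⁻¹ 2 - (a * z ^ 2).re| ≤ (1 + ‖b‖) * ‖z‖ + B := by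
    intro z hz
    have hRn : ‖(R : ℂ)‖ = R := by simp [abs_of_pos hR0]
    have h1 := hL z R hz hRn.ge
    have h2 : ‖z - R‖ ≤ ‖z‖ + R := (norm_sub_le _ _).trans_eq (by rw [hRn])
    have h3 : |(b * z).re| ≤ ‖b‖ * ‖z‖ := (Complex.abs_re_le_norm _).trans_eq (norm_mul _ _)
    have h4 : |e.toFun z⁻¹ 2 - (a * z ^ 2 + b * z).re|
        ≤ ‖z‖ + R + |e.toFun (R : ℂ)⁻¹ 2 - (a * R ^ 2 + b * R).re| := by
      have := abs_sub_abs_le_abs_sub (e.toFun z⁻¹ 2 - (a * z ^ 2 + b * z).re)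
        (e.toFun (R : ℂ)⁻¹ 2 - (a * R ^ 2 + b * R).re)
      simp only at h1
      linarith
    have h5 : e.toFun z⁻¹ 2 - (a * z ^ 2).re
        = (e.toFun z⁻¹ 2 - (a * z ^ 2 + b * z).re) + (b * z).re := by
      rw [Complex.add_re]; ring
    rw [h5]
    refine (abs_add_le _ _).trans ?_
    linarith
  have hB0 : 0 < B := by positivity
  have ha0 : 0 < ‖a‖ := norm_pos_iff.2 ha
  -- On the circle of radius `N` the quadratic term dominates `hbound`, and inverses of its points
  -- are within `δ`, `δ₀` and `δ₁` of the puncture.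
  obtain ⟨N, hN⟩ := ((((eventually_gt_atTop R).and (eventually_gt_atTop δ⁻¹)).and
    ((eventually_gt_atTop δ₀⁻¹).and (eventually_gt_atTop δ₁⁻¹))).and
    ((eventually_gt_atTop 1).and
      (eventually_gt_atTop ((1 + ‖b‖ + B) / ‖a‖)))).exists
  obtain ⟨⟨⟨hNR, hNδ⟩, hNδ₀, hNδ₁⟩, hN1, hNa⟩ := hN
  have hN0 : 0 < N := by linarith
  let γ : ℝ → ℂ := fun t => N * Complex.exp (t * Complex.I)
  have hγ : Continuous γ := by fun_prop
  have hγN : ∀ t, ‖γ t‖ = N := fun t => by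
    simp [γ, Complex.norm_exp_ofReal_mul_I, abs_of_pos hN0]
  have hg : Continuous (fun t => e.toFun (γ t)⁻¹ 2) :=
    (e.continuousOn_toFun_inv 2 hR).comp_continuous hγ fun t => hNR.le.trans_eq (hγN t).symm
  have hbig : (1 + ‖b‖) * N + B ≤ ‖a‖ * N ^ 2 := by
    rw [div_lt_iff₀ ha0] at hNa
    nlinarith
  -- At this angle aζ² is positive; a quarter turn later it is negative, so the third coordinate has
  -- a zero on the circle.
  have hθ : a * γ (-a.arg / 2) ^ 2 = ((‖a‖ * N ^ 2 : ℝ) : ℂ) := by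
    calc _ = (‖a‖ * Complex.exp (a.arg * Complex.I)) * γ (-a.arg / 2) ^ 2 := by
          rw [Complex.norm_mul_exp_arg_mul_I]
      _ = (‖a‖ : ℂ) * N ^ 2 * (Complex.exp (a.arg * Complex.I)
          * Complex.exp (((2 : ℕ) : ℂ) * (((-a.arg / 2 : ℝ) : ℂ) * Complex.I))) := by
        simp only [γ, mul_pow, ← Complex.exp_nat_mul]
        ring
      _ = _ := by
        rw [← Complex.exp_add]
        have : (a.arg : ℂ) * Complex.I
            + ((2 : ℕ) : ℂ) * (((-a.arg / 2 : ℝ) : ℂ) * Complex.I) = 0 := by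
          push_cast; ring
        rw [this]
        simp
  have hθ' : a * γ (-a.arg / 2 + Real.pi / 2) ^ 2 = -((‖a‖ * N ^ 2 : ℝ) : ℂ) := by
    rw [← hθ]
    have : γ (-a.arg / 2 + Real.pi / 2) = γ (-a.arg / 2) * Complex.I := by
      simp only [γ]
      push_cast
      rw [add_mul, Complex.exp_add, Complex.exp_pi_div_two_mul_I]
      ring
    rw [this, mul_pow, Complex.I_sq]
    ring
  obtain ⟨t, ht⟩ : (0 : ℝ) ∈ Set.range (fun t => e.toFun (γ t)⁻¹ 2) := by
    refine mem_range_of_exists_le_of_exists_ge hg ⟨-a.arg / 2 + Real.pi / 2, ?_⟩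
      ⟨-a.arg / 2, ?_⟩
    · have h1 := hbound _ (hNR.le.trans_eq (hγN (-a.arg / 2 + Real.pi / 2)).symm)
      rw [hθ', hγN, Complex.neg_re, Complex.ofReal_re] at h1
      linarith [(abs_le.1 h1).2]
    · have h1 := hbound _ (hNR.le.trans_eq (hγN (-a.arg / 2)).symm)
      rw [hθ, hγN, Complex.ofReal_re] at h1
      linarith [(abs_le.1 h1).1]
  have hz0 : 0 < ‖(γ t)⁻¹‖ := by rw [norm_inv, hγN]; positivity
  refine ⟨(γ t)⁻¹, hz0, ?_, (norm_le_add_add _).trans ?_⟩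
  · rw [norm_inv, hγN]
    exact inv_le_of_inv_le₀ hδ hNδ.le
  · have e0 := hC₀ _ hz0 (by rw [norm_inv, hγN]; exact inv_lt_of_inv_lt₀ hδ₀ hNδ₀)
    have e1 := hC₁ _ hz0 (by rw [norm_inv, hγN]; exact inv_lt_of_inv_lt₀ hδ₁ hNδ₁)
    have e2 : e.toFun (γ t)⁻¹ 2 = 0 := ht
    rw [e2, abs_zero]
    linarith

/-- Injectivity is immediate, and properness holds because |z⁻¹| tends to infinity. For the
immersion, |z - w| ≤ |z⁻¹ - w⁻¹| inside the unit disk, so difference quotients along a line bound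
|v| by the derivative. -/
theorem isProperlyEmbedded_of_antilipschitz (e : MeromorphicEnd) {r C : ℝ} (hr0 : 0 < r)
    (hr1 : r < 1) (h : ∀ z ∈ closedPuncturedDisk r, ∀ w ∈ closedPuncturedDisk r,
      ‖z⁻¹ - w⁻¹‖ ≤ C * ‖e.toFun z - e.toFun w‖) : e.IsProperlyEmbedded := by
  have hsub : closedPuncturedDisk (r / 2) ⊆ closedPuncturedDisk r := fun z hz =>
    ⟨hz.1, hz.2.trans (by linarith)⟩
  have hinj : Set.InjOn e.toFun (closedPuncturedDisk r) := by
    intro z hz w hw hzw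
    have h1 := h z hz w hw
    rw [hzw, sub_self, norm_zero, mul_zero, norm_le_zero_iff, sub_eq_zero] at h1
    exact inv_injective h1
  -- Halving the radius makes every point interior to the region of the estimate, so that it can be
  -- differentiated there in all directions.
  refine ⟨r / 2, by linarith, by linarith, e.isProperMap_of_tendsto (fun B => ?_) (by linarith),
    hinj.mono hsub, fun z hz => ?_⟩
  · have hr : (r : ℂ) ∈ closedPuncturedDisk r := by
      simp [closedPuncturedDisk, abs_of_pos hr0, hr0.ne']
    set D := ‖(r : ℂ)⁻¹‖ + |C| * (|B| + ‖e.toFun r‖) + 1 with hD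
    have hD0 : 0 < D := by positivity
    refine ⟨min r D⁻¹, by positivity, fun z hz hzδ => ?_⟩
    by_contra! hle
    have h1 := h z ⟨hz.1, (hzδ.trans_le (min_le_left _ _)).le⟩ r hr
    have h2 : ‖e.toFun z - e.toFun r‖ ≤ |B| + ‖e.toFun r‖ :=
      (norm_sub_le _ _).trans (by linarith [le_abs_self B])
    have h3 : ‖z⁻¹ - (r : ℂ)⁻¹‖ ≤ |C| * (|B| + ‖e.toFun r‖) :=
      h1.trans (mul_le_mul (le_abs_self C) h2 (norm_nonneg _) (abs_nonneg _))
    have h4 := norm_sub_norm_le z⁻¹ (r : ℂ)⁻¹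
    have h5 : D < ‖z⁻¹‖ := by
      rw [norm_inv]
      exact lt_inv_of_lt_inv₀ hz.1 (hzδ.trans_le (min_le_right _ _))
    linarith
  · rw [injective_iff_map_eq_zero]
    intro v hv
    have hzd : z ∈ puncturedDisk := closedPuncturedDisk_subset (by linarith) hz
    have hline : HasDerivAt (fun t : ℝ => z + t * v) v 0 := by
      simpa using ((Complex.ofRealCLM.hasDerivAt (x := 0)).mul_const v).const_add z
    have hd : HasDerivAt (fun t : ℝ => e.toFun (z + t * v)) 0 0 := by
      have h1 : HasFDerivAt e.toFun (fderiv ℝ e.toFun z) (z + ((0 : ℝ) : ℂ) * v) := by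
        simpa using (e.differentiableAt_toFun hzd).hasFDerivAt
      have h2 := h1.comp_hasDerivAt (0 : ℝ) hline
      rwa [hv] at h2
    have hlim := (hd.tendsto_slope_zero.norm.const_mul C)
    simp only [norm_zero, mul_zero, zero_add, Complex.ofReal_zero, zero_mul, add_zero] at hlim
    have hnear : ∀ᶠ t : ℝ in 𝓝[≠] 0, z + t * v ∈ closedPuncturedDisk r := by
      have h1 : ContinuousAt (fun t : ℝ => z + t * v) 0 := hline.continuousAt
      have h2 : {w : ℂ | 0 < ‖w‖ ∧ ‖w‖ < r} ∈ 𝓝 z :=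
        ((isOpen_lt continuous_const continuous_norm).inter
          (isOpen_lt continuous_norm continuous_const)).mem_nhds
          ⟨hz.1, hz.2.trans_lt (by linarith)⟩
      have h3 := h1.eventually_mem (s := {w : ℂ | 0 < ‖w‖ ∧ ‖w‖ < r}) (by simpa using h2)
      filter_upwards [mem_nhdsWithin_of_mem_nhds h3] with t ht
      exact ⟨ht.1, ht.2.le⟩
    have hv0 : ‖v‖ ≤ 0 := by
      refine ge_of_tendsto hlim ?_
      filter_upwards [hnear, self_mem_nhdsWithin] with t ht ht0
      have ht0 : t ≠ 0 := ht0
      have h1 := h _ ht z (hsub hz)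
      have hz0 : z ≠ 0 := norm_pos_iff.1 hz.1
      have hw0 : z + t * v ≠ 0 := norm_pos_iff.1 ht.1
      have h2 : ‖z⁻¹ - (z + t * v)⁻¹‖ * (‖z‖ * ‖z + t * v‖) = |t| * ‖v‖ := by
        rw [inv_sub_inv hz0 hw0, norm_div, norm_mul, div_mul_cancel₀ _ (by positivity)]
        simp
      have h3 : ‖z‖ * ‖z + t * v‖ ≤ 1 :=
        mul_le_one₀ (by linarith [hz.2]) (norm_nonneg _) (by linarith [ht.2])
      have h4 : |t| * ‖v‖ ≤ ‖z⁻¹ - (z + t * v)⁻¹‖ := by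
        rw [← h2]
        exact mul_le_of_le_one_right (norm_nonneg _) h3
      rw [norm_sub_rev] at h4
      have ht' : 0 < |t| := abs_pos.2 ht0
      rw [norm_smul, norm_inv, Real.norm_eq_abs]
      rw [← mul_le_mul_iff_right₀ ht']
      calc |t| * ‖v‖ ≤ _ := h4.trans h1
        _ = _ := by field_simp
    exact norm_le_zero_iff.1 hv0

/-- If two coordinates have poles of order 2 with independent leading coefficients, the end is
properly embedded. -/
theorem isProperlyEmbedded_of_hasExpansion (e : MeromorphicEnd) {b₀ b₁ : ℂ} {c₀ c₁ : ℝ}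
    {H₀ H₁ : ℂ → ℂ} (h₀ : HasExpansion (fun z => e.toFun z 0) 0 b₀ c₀ H₀)
    (h₁ : HasExpansion (fun z => e.toFun z 1) 0 b₁ c₁ H₁)
    (hb : ∀ s t : ℝ, (s : ℂ) * b₀ + t * b₁ = 0 → s = 0 ∧ t = 0) : e.IsProperlyEmbedded := by
  obtain ⟨Λ, hΛ⟩ := exists_continuousLinearEquiv_re_mul hb
  set N := ‖(Λ.symm : ℂ →L[ℝ] ℂ)‖ + 1 with hN
  have hN0 : 0 < N := by positivity
  -- Two coordinates, each with error |d|/(4N), contribute |d|/2 after applying the inverse of `Λ`;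
  -- this is absorbed on the left.
  obtain ⟨R₀, hR₀, hL₀⟩ := h₀.exists_lipschitz (ε := 1 / (4 * N)) (by positivity)
  obtain ⟨R₁, hR₁, hL₁⟩ := h₁.exists_lipschitz (ε := 1 / (4 * N)) (by positivity)
  set R := max R₀ R₁ with hR
  have hR1 : 1 < R := hR₀.trans_le (le_max_left _ _)
  have hR0 : 0 < R := by linarith
  refine e.isProperlyEmbedded_of_antilipschitz (r := R⁻¹) (C := 4 * N) (inv_pos.2 hR0)
    (inv_lt_one_of_one_lt₀ hR1) fun z hz w hw => ?_
  have hfar : ∀ z ∈ closedPuncturedDisk R⁻¹, R ≤ ‖z⁻¹‖ := by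
    intro z hz
    rw [norm_inv]
    exact le_inv_of_le_inv₀ hz.1 hz.2
  have e0 := hL₀ z⁻¹ w⁻¹ ((le_max_left _ _).trans (hfar z hz)) ((le_max_left _ _).trans (hfar w hw))
  have e1 := hL₁ z⁻¹ w⁻¹ ((le_max_right _ _).trans (hfar z hz))
    ((le_max_right _ _).trans (hfar w hw))
  simp only [inv_inv, zero_mul, zero_add] at e0 e1
  have d0 := abs_apply_sub_le (e.toFun z) (e.toFun w) 0
  have d1 := abs_apply_sub_le (e.toFun z) (e.toFun w) 1
  have key : ∀ x y p q D ε : ℝ, |x - p - (y - q)| ≤ ε → |x - y| ≤ D → |p - q| ≤ D + ε := by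
    intro x y p q D ε h h'
    rw [abs_le] at *
    constructor <;> linarith
  have f0 := key _ _ _ _ _ _ e0 d0
  have f1 := key _ _ _ _ _ _ e1 d1
  set d := z⁻¹ - w⁻¹ with hd
  rw [← Complex.sub_re, ← mul_sub] at f0 f1
  have hΛd : ‖Λ d‖ ≤ |(b₀ * d).re| + |(b₁ * d).re| := by
    refine (Complex.norm_le_abs_re_add_abs_im _).trans_eq ?_
    simp [hΛ]
  have hd' : ‖d‖ ≤ N * ‖Λ d‖ := by
    have := (Λ.symm : ℂ →L[ℝ] ℂ).le_opNorm (Λ d)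
    simp only [ContinuousLinearEquiv.coe_coe, ContinuousLinearEquiv.symm_apply_apply] at this
    exact this.trans (mul_le_mul_of_nonneg_right (by linarith) (norm_nonneg _))
  have h2 : N * ‖Λ d‖ ≤ N * (2 * ‖e.toFun z - e.toFun w‖ + 2 * (1 / (4 * N) * ‖d‖)) :=
    mul_le_mul_of_nonneg_left (by linarith) hN0.le
  have h3 : N * (2 * (1 / (4 * N) * ‖d‖)) = ‖d‖ / 2 := by field_simp; norm_num
  rw [mul_add, h3] at h2
  linarith

end MeromorphicEnd

/-! ### Explicit ends. -/

namespace HasLaurent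

variable {g h : ℂ → ℂ} {a b c : ℂ}

theorem poleOrder_eq_three (H : HasLaurent g a b c h) (ha : a ≠ 0) : poleOrder g = 3 :=
  le_antisymm H.poleOrder_le_three
    (by by_contra! hlt; exact ha (H.poleOrder_le_two_iff.1 (by omega)))

theorem poleOrder_eq_two (H : HasLaurent g a b c h) (ha : a = 0) (hb : b ≠ 0) :
    poleOrder g = 2 :=
  le_antisymm (H.poleOrder_le_two_iff.2 ha)
    (by by_contra! hlt; exact hb (H.poleOrder_le_one_iff.1 (by omega)).2)

theorem poleOrder_eq_one (H : HasLaurent g a b c h) (ha : a = 0) (hb : b = 0) (hc : c ≠ 0) :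
    poleOrder g = 1 :=
  le_antisymm (H.poleOrder_le_one_iff.2 ⟨ha, hb⟩)
    (by by_contra! hlt; exact hc (H.poleOrder_le_zero_iff.1 (by omega)).2.2)

theorem poleOrder_eq_zero (H : HasLaurent g a b c h) (ha : a = 0) (hb : b = 0) (hc : c = 0) :
    poleOrder g = 0 := Nat.le_zero.1 (H.poleOrder_le_zero_iff.2 ⟨ha, hb, hc⟩)

end HasLaurent

theorem hasFDerivAt_log_norm {z : ℂ} (hz : z ≠ 0) :
    HasFDerivAt (fun w : ℂ => Real.log ‖w‖)
      (Complex.reCLM.comp (ContinuousLinearMap.mul ℝ ℂ z⁻¹)) z := by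
  have hn : ‖z‖ ^ 2 ≠ 0 := by simpa using hz
  have h1 := ((hasStrictFDerivAt_norm_sq z).hasFDerivAt.log hn).const_mul (1 / 2)
  have h2 : (fun w : ℂ => Real.log ‖w‖) = fun w => 1 / 2 * Real.log (‖w‖ ^ 2) := by
    ext w
    rw [Real.log_pow]
    push_cast
    ring
  rw [h2]
  refine h1.congr_fderiv ?_
  ext v
  simp [Complex.inner, Complex.inv_re, Complex.inv_im, ← Complex.normSq_eq_norm_sq]
  field_simp
  ring

/-- Turns the immersion conditions of the examples into polynomial equations. -/
theorem re_mul_inv_eq_zero_iff {p w : ℂ} (hw : w ≠ 0) :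
    (p * w⁻¹).re = 0 ↔ p.re * w.re + p.im * w.im = 0 := by
  have hn : Complex.normSq w ≠ 0 := by simpa using hw
  have : (p * w⁻¹).re = (p.re * w.re + p.im * w.im) / Complex.normSq w := by
    simp [Complex.inv_re, Complex.inv_im]
    ring
  rw [this, div_eq_zero_iff, or_iff_left hn]

namespace MeromorphicEnd

/-- The end with coordinates `Re (α z⁻² + β z⁻¹ + γ z) + c log |z|`. -/
noncomputable def ofCoeffs (α β γ : Fin 3 → ℂ) (c : Fin 3 → ℝ) : MeromorphicEnd where
  toFun z := WithLp.toLp 2 fun k =>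
    (α k * (z ^ 2)⁻¹ + β k * z⁻¹ + γ k * z).re + c k * Real.log ‖z‖
  form k z := -2 * α k * (z ^ 3)⁻¹ + -β k * (z ^ 2)⁻¹ + c k * z⁻¹ + γ k
  form_holomorphic k z hz := by
    have hz0 : z ≠ 0 := norm_pos_iff.1 hz.1
    refine DifferentiableAt.differentiableWithinAt ?_
    fun_prop (disch := simpa using hz0)
  form_meromorphic k := by fun_prop
  hasFDerivAt_toFun k z hz := by
    have hz0 : z ≠ 0 := norm_pos_iff.1 hz.1
    have h1 := (((hasDerivAt_pow 2 z).fun_inv (pow_ne_zero 2 hz0)).const_mul (α k)).add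
      ((hasDerivAt_inv hz0).const_mul (β k)) |>.add ((hasDerivAt_id z).const_mul (γ k))
    have h2 := (Complex.reCLM.hasFDerivAt.comp z (h1.hasFDerivAt.restrictScalars ℝ)).add
      ((hasFDerivAt_log_norm hz0).const_mul (c k))
    refine h2.congr_fderiv ?_
    ext v
    have e1 : -2 * α k * (z ^ 3)⁻¹ + -β k * (z ^ 2)⁻¹ + c k * z⁻¹ + γ k
        = (α k * (-(((2 : ℕ) : ℂ) * z ^ (2 - 1)) / (z ^ 2) ^ 2) + β k * -(z ^ 2)⁻¹ + γ k * 1)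
          + c k * z⁻¹ := by
      field_simp
      push_cast
      ring
    simp only [add_apply, smul_apply, ContinuousLinearMap.comp_apply,
      ContinuousLinearMap.mul_apply', Complex.reCLM_apply, ContinuousLinearMap.coe_restrictScalars',
      ContinuousLinearMap.toSpanSingleton_apply, smul_eq_mul]
    rw [e1, add_mul, Complex.add_re, mul_assoc (c k : ℂ), Complex.re_ofReal_mul, mul_comm v]

variable {α β γ : Fin 3 → ℂ} {c : Fin 3 → ℝ}

theorem ofCoeffs_apply (z : ℂ) (k : Fin 3) : (ofCoeffs α β γ c).toFun z k
    = (α k * (z ^ 2)⁻¹ + β k * z⁻¹ + γ k * z).re + c k * Real.log ‖z‖ := rfl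

theorem hasLaurent_ofCoeffs (k : Fin 3) :
    HasLaurent ((ofCoeffs α β γ c).form k) (-2 * α k) (-β k) (c k) (fun _ => γ k) :=
  ⟨analyticAt_const, Eventually.of_forall fun _ => rfl⟩

theorem hasLaurent_combo_ofCoeffs (s : Fin 3 → ℝ) :
    HasLaurent ((ofCoeffs α β γ c).combo s) (∑ k, s k * (-2 * α k)) (∑ k, s k * -β k)
      (∑ k, s k * c k) (fun _ => ∑ k, s k * γ k) :=
  HasLaurent.sum hasLaurent_ofCoeffs s

/-- The differential in the coordinate ζ = 1/z: `p` is the tangent vector dζ = -dz/z². Writing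
everything through `z⁻¹` lets it be replaced by a single variable. -/
theorem ofCoeffs_fderiv_injective {z : ℂ} (hz : z ∈ puncturedDisk)
    (h : ∀ p : ℂ, (∀ k, (2 * α k * z⁻¹ * p + β k * p).re - c k * (p * (z⁻¹)⁻¹).re
      - (γ k * p * ((z⁻¹) ^ 2)⁻¹).re = 0) → p = 0) :
    Function.Injective (fderiv ℝ (ofCoeffs α β γ c).toFun z) := by
  have hz0 : z ≠ 0 := norm_pos_iff.1 hz.1
  refine fderiv_injective_of_form _ hz fun v hv => ?_
  have h1 := h (-v * (z ^ 2)⁻¹) fun k => by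
    rw [← hv k, ← Complex.re_ofReal_mul, ← Complex.sub_re, ← Complex.sub_re]
    congr 1
    simp only [ofCoeffs]
    field_simp
    ring
  simpa [hz0] using h1

/-- The conjugate points ir and -ir have the same image. -/
theorem not_isProperlyEmbedded_of_conj (e : MeromorphicEnd)
    (h : ∀ z, e.toFun (starRingEnd ℂ z) = e.toFun z) : ¬ e.IsProperlyEmbedded := by
  rintro ⟨r, hr0, hr1, -, hinj, -⟩
  have hm : ∀ s : ℝ, |s| = r → (s : ℂ) * Complex.I ∈ closedPuncturedDisk r := by
    intro s hs
    simp [closedPuncturedDisk, hs]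
    rintro rfl
    simp at hs
    exact hr0.ne hs
  have h1 := hinj (hm r (abs_of_pos hr0)) (hm (-r) (by rw [abs_neg, abs_of_pos hr0])) (by
    rw [← h]
    simp)
  have h2 := congrArg Complex.im h1
  simp at h2
  linarith

theorem ofCoeffs_not_isProperlyEmbedded (hα : ∀ k, (α k).im = 0) (hβ : ∀ k, (β k).im = 0)
    (hγ : ∀ k, (γ k).im = 0) : ¬ (ofCoeffs α β γ c).IsProperlyEmbedded := by
  have hc : ∀ a : ℂ, a.im = 0 → ∀ w, (a * starRingEnd ℂ w).re = (a * w).re := by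
    intro a ha w
    simp [Complex.mul_re, ha]
  refine not_isProperlyEmbedded_of_conj _ fun z => ?_
  ext k
  rw [ofCoeffs_apply, ofCoeffs_apply, ← map_pow, ← map_inv₀, ← map_inv₀, Complex.norm_conj]
  simp only [Complex.add_re, hc _ (hα k), hc _ (hβ k), hc _ (hγ k)]

theorem isProperMap_of_apply_eq_log (e : MeromorphicEnd) (k : Fin 3)
    (h : ∀ z ∈ puncturedDisk, e.toFun z k = Real.log ‖z‖) {r : ℝ} (hr : r < 1) :
    IsProperMap (fun z : closedPuncturedDisk r => e.toFun z) := by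
  refine e.isProperMap_of_tendsto (fun C => ⟨Real.exp (-C), Real.exp_pos _, fun z hz hzC => ?_⟩) hr
  have h1 : Real.log ‖z‖ < -C := (Real.log_lt_iff_lt_exp hz.1).2 hzC
  have h2 : |e.toFun z k| ≤ ‖e.toFun z‖ := PiLp.norm_apply_le (e.toFun z) k
  rw [h z hz] at h2
  linarith [neg_abs_le (Real.log ‖z‖)]

/-- The norm, the real part and `Re (ζ² + i ζ)` determine `ζ`. -/
theorem eq_of_normSq_eq {z w : ℂ} (h0 : Complex.normSq z = Complex.normSq w) (h1 : z.re = w.re)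
    (h2 : (z ^ 2 + Complex.I * z).re = (w ^ 2 + Complex.I * w).re) : z = w := by
  simp only [Complex.normSq_apply, pow_two, Complex.add_re, Complex.mul_re, Complex.I_re,
    Complex.I_im, h1] at h0 h2
  exact Complex.ext h1 (by linarith)

theorem isReduced_ofCoeffs_223 :
    (ofCoeffs ![0, 0, 1] ![1, Complex.I, 0] 0 0).IsReduced ∧
      (ofCoeffs ![0, 0, 1] ![1, Complex.I, 0] 0 0).poleOrders = ![2, 2, 3] := by
  have hn : (ofCoeffs ![0, 0, 1] ![1, Complex.I, 0] 0 0).poleOrders = ![2, 2, 3] := by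
    rw [poleOrders_eq]
    ext k
    fin_cases k
    · exact (hasLaurent_ofCoeffs 0).poleOrder_eq_two (by simp) (by simp)
    · exact (hasLaurent_ofCoeffs 1).poleOrder_eq_two (by simp) (by simp)
    · exact (hasLaurent_ofCoeffs 2).poleOrder_eq_three (by simp)
  refine ⟨isReduced_of_combo ?_ fun s k hk => ?_, hn⟩
  · rw [hn]
    decide
  have hL := hasLaurent_combo_ofCoeffs (α := ![0, 0, 1]) (β := ![1, Complex.I, 0]) (γ := 0)
    (c := 0) s
  rw [hn] at hk
  simp only [Fin.sum_univ_three] at hL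
  fin_cases k
  · have := (hL.poleOrder_le_one_iff.1 (Nat.le_of_lt_succ hk)).2
    simpa using congrArg Complex.re this
  · have := (hL.poleOrder_le_one_iff.1 (Nat.le_of_lt_succ hk)).2
    simpa using congrArg Complex.im this
  · simpa using hL.poleOrder_le_two_iff.1 (Nat.le_of_lt_succ hk)

/-- The parameter does not affect the type: `I` gives an embedded end and 0 one that is invariant
under conjugation. The types (0,2,3) and (0,1,3) are treated in the same way. -/
theorem isReduced_ofCoeffs_123 (b : ℂ) :
    (ofCoeffs ![0, 0, 1] ![0, 1, b] 0 ![1, 0, 0]).IsReduced ∧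
      (ofCoeffs ![0, 0, 1] ![0, 1, b] 0 ![1, 0, 0]).poleOrders = ![1, 2, 3] := by
  have hn : (ofCoeffs ![0, 0, 1] ![0, 1, b] 0 ![1, 0, 0]).poleOrders = ![1, 2, 3] := by
    rw [poleOrders_eq]
    ext k
    fin_cases k
    · exact (hasLaurent_ofCoeffs 0).poleOrder_eq_one (by simp) (by simp) (by simp)
    · exact (hasLaurent_ofCoeffs 1).poleOrder_eq_two (by simp) (by simp)
    · exact (hasLaurent_ofCoeffs 2).poleOrder_eq_three (by simp)
  refine ⟨isReduced_of_combo ?_ fun s k hk => ?_, hn⟩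
  · rw [hn]
    decide
  have hL := hasLaurent_combo_ofCoeffs (α := ![0, 0, 1]) (β := ![0, 1, b]) (γ := 0)
    (c := ![1, 0, 0]) s
  rw [hn] at hk
  simp only [Fin.sum_univ_three] at hL
  fin_cases k
  · simpa using (hL.poleOrder_le_zero_iff.1 (Nat.le_of_lt_succ hk)).2.2
  · have := hL.poleOrder_le_one_iff.1 (Nat.le_of_lt_succ hk)
    have h2 : s 2 = 0 := by simpa using this.1
    simpa [h2] using this.2
  · simpa using hL.poleOrder_le_two_iff.1 (Nat.le_of_lt_succ hk)

theorem isReduced_ofCoeffs_023 (g : ℂ) :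
    (ofCoeffs ![0, 0, 1] ![0, 1, 0] ![g, 0, 0] 0).IsReduced ∧
      (ofCoeffs ![0, 0, 1] ![0, 1, 0] ![g, 0, 0] 0).poleOrders = ![0, 2, 3] := by
  have hn : (ofCoeffs ![0, 0, 1] ![0, 1, 0] ![g, 0, 0] 0).poleOrders = ![0, 2, 3] := by
    rw [poleOrders_eq]
    ext k
    fin_cases k
    · exact (hasLaurent_ofCoeffs 0).poleOrder_eq_zero (by simp) (by simp) (by simp)
    · exact (hasLaurent_ofCoeffs 1).poleOrder_eq_two (by simp) (by simp)
    · exact (hasLaurent_ofCoeffs 2).poleOrder_eq_three (by simp)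
  refine ⟨isReduced_of_combo ?_ fun s k hk => ?_, hn⟩
  · rw [hn]
    decide
  have hL := hasLaurent_combo_ofCoeffs (α := ![0, 0, 1]) (β := ![0, 1, 0]) (γ := ![g, 0, 0])
    (c := 0) s
  rw [hn] at hk
  simp only [Fin.sum_univ_three] at hL
  fin_cases k
  · exact absurd hk (Nat.not_lt_zero _)
  · simpa using (hL.poleOrder_le_one_iff.1 (Nat.le_of_lt_succ hk)).2
  · simpa using hL.poleOrder_le_two_iff.1 (Nat.le_of_lt_succ hk)

theorem isReduced_ofCoeffs_013 (b : ℂ) :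
    (ofCoeffs ![0, 0, 1] ![0, 0, b] ![1, 0, 0] ![0, 1, 0]).IsReduced ∧
      (ofCoeffs ![0, 0, 1] ![0, 0, b] ![1, 0, 0] ![0, 1, 0]).poleOrders = ![0, 1, 3] := by
  have hn : (ofCoeffs ![0, 0, 1] ![0, 0, b] ![1, 0, 0] ![0, 1, 0]).poleOrders = ![0, 1, 3] := by
    rw [poleOrders_eq]
    ext k
    fin_cases k
    · exact (hasLaurent_ofCoeffs 0).poleOrder_eq_zero (by simp) (by simp) (by simp)
    · exact (hasLaurent_ofCoeffs 1).poleOrder_eq_one (by simp) (by simp) (by simp)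
    · exact (hasLaurent_ofCoeffs 2).poleOrder_eq_three (by simp)
  refine ⟨isReduced_of_combo ?_ fun s k hk => ?_, hn⟩
  · rw [hn]
    decide
  have hL := hasLaurent_combo_ofCoeffs (α := ![0, 0, 1]) (β := ![0, 0, b]) (γ := ![1, 0, 0])
    (c := ![0, 1, 0]) s
  rw [hn] at hk
  simp only [Fin.sum_univ_three] at hL
  fin_cases k
  · exact absurd hk (Nat.not_lt_zero _)
  · simpa using (hL.poleOrder_le_zero_iff.1 (Nat.le_of_lt_succ hk)).2.2
  · simpa using hL.poleOrder_le_two_iff.1 (Nat.le_of_lt_succ hk)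

theorem inv_normSq_eq_of_log_norm_eq {z w : ℂ} (hz : z ∈ puncturedDisk) (hw : w ∈ puncturedDisk)
    (h : Real.log ‖z‖ = Real.log ‖w‖) : Complex.normSq z⁻¹ = Complex.normSq w⁻¹ := by
  rw [Complex.normSq_eq_norm_sq, Complex.normSq_eq_norm_sq, norm_inv, norm_inv,
    Real.log_injOn_pos hz.1 hw.1 h]

/-- The coordinates are -log |ζ|, Re ζ and Re (ζ² + iζ). The first is proper; the first two
determine ζ up to conjugation, and the third then fixes Im ζ. -/
theorem isProperlyEmbedded_ofCoeffs_123 :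
    (ofCoeffs ![0, 0, 1] ![0, 1, Complex.I] 0 ![1, 0, 0]).IsProperlyEmbedded := by
  refine ⟨1 / 2, by norm_num, by norm_num, isProperMap_of_apply_eq_log _ 0 ?_ (by norm_num), ?_,
    fun z hz => ofCoeffs_fderiv_injective (closedPuncturedDisk_subset (by norm_num) hz) ?_⟩
  · intro z _
    simp [ofCoeffs_apply]
  · intro z hz w hw h
    have hz' := closedPuncturedDisk_subset (by norm_num) hz
    have hw' := closedPuncturedDisk_subset (by norm_num) hw
    have h0 := congrArg (fun x => x 0) h
    have h1 := congrArg (fun x => x 1) h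
    have h2 := congrArg (fun x => x 2) h
    simp only [ofCoeffs_apply] at h0 h1 h2
    refine inv_injective (eq_of_normSq_eq (inv_normSq_eq_of_log_norm_eq hz' hw' ?_) ?_ ?_)
    · simpa using h0
    · simpa using h1
    · simpa using h2
  · intro p hp
    have hz0 : z⁻¹ ≠ 0 := inv_ne_zero (norm_pos_iff.1 hz.1)
    generalize z⁻¹ = u at *
    have h0 : (p * u⁻¹).re = 0 := by simpa [-Complex.mul_re] using hp 0
    have h1 : p.re = 0 := by simpa using hp 1
    have h2 := hp 2
    rw [re_mul_inv_eq_zero_iff hz0] at h0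
    simp [h1] at h0 h2
    rcases h0 with h0 | h0
    · exact Complex.ext h1 h0
    · exact Complex.ext h1 (by simpa [h0] using h2)

/-- Here Re z = Re ζ / |ζ|², so together with |ζ| it gives Re ζ, and the argument for (1,2,3)
applies. -/
theorem isProperlyEmbedded_ofCoeffs_013 :
    (ofCoeffs ![0, 0, 1] ![0, 0, Complex.I] ![1, 0, 0] ![0, 1, 0]).IsProperlyEmbedded := by
  refine ⟨1 / 2, by norm_num, by norm_num, isProperMap_of_apply_eq_log _ 1 ?_ (by norm_num), ?_,
    fun z hz => ofCoeffs_fderiv_injective (closedPuncturedDisk_subset (by norm_num) hz) ?_⟩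
  · intro z _
    simp [ofCoeffs_apply]
  · intro z hz w hw h
    have hz' := closedPuncturedDisk_subset (by norm_num) hz
    have hw' := closedPuncturedDisk_subset (by norm_num) hw
    have h0 := congrArg (fun x => x 0) h
    have h1 := congrArg (fun x => x 1) h
    have h2 := congrArg (fun x => x 2) h
    simp only [ofCoeffs_apply] at h0 h1 h2
    have hn := inv_normSq_eq_of_log_norm_eq hz' hw' (by simpa using h1)
    refine inv_injective (eq_of_normSq_eq hn ?_ ?_)
    · have h3 : z.re = w.re := by simpa using h0
      rw [map_inv₀, map_inv₀, inv_inj] at hn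
      rw [Complex.inv_re, Complex.inv_re, hn, h3]
    · simpa using h2
  · intro p hp
    have hz0 : z⁻¹ ≠ 0 := inv_ne_zero (norm_pos_iff.1 hz.1)
    generalize z⁻¹ = u at *
    have h0 : (p * (u ^ 2)⁻¹).re = 0 := by simpa [-Complex.mul_re] using hp 0
    have h1 : (p * u⁻¹).re = 0 := by simpa [-Complex.mul_re] using hp 1
    have h2 := hp 2
    rw [re_mul_inv_eq_zero_iff (pow_ne_zero 2 hz0)] at h0
    rw [re_mul_inv_eq_zero_iff hz0] at h1
    simp [pow_two] at h0 h2
    have h3 : u.im * (p.im * u.re - p.re * u.im) = 0 := by linear_combination h0 - u.re * h1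
    rcases mul_eq_zero.1 h3 with h3 | h3
    · have hre : u.re ≠ 0 := fun h => hz0 (Complex.ext h h3)
      have h4 : p.re = 0 := by simpa [h3, hre] using h1
      exact Complex.ext h4 (by simpa [h3, h4] using h2)
    -- Now `p` is both orthogonal and parallel to `u`, so |p|² u = 0.
    · have h4 : Complex.normSq p * u.re = 0 := by
        rw [Complex.normSq_apply]; linear_combination p.re * h1 + p.im * h3
      have h5 : Complex.normSq p * u.im = 0 := by
        rw [Complex.normSq_apply]; linear_combination p.im * h1 - p.re * h3
      by_contra hp0
      have hn : Complex.normSq p ≠ 0 := by simpa using hp0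
      exact hz0 (Complex.ext ((mul_eq_zero.1 h4).resolve_left hn)
        ((mul_eq_zero.1 h5).resolve_left hn))

/-- The coordinates are Im z, Re ζ and Re ζ². Since |ζ|² = 2 (Re ζ)² - Re ζ², the last two give
properness and determine |ζ|, hence Re z; the first gives Im z. -/
theorem isProperlyEmbedded_ofCoeffs_023 :
    (ofCoeffs ![0, 0, 1] ![0, 1, 0] ![-Complex.I, 0, 0] 0).IsProperlyEmbedded := by
  refine ⟨1 / 2, by norm_num, by norm_num, isProperMap_of_tendsto _ (fun B => ?_) (by norm_num), ?_,
    fun z hz => ofCoeffs_fderiv_injective (closedPuncturedDisk_subset (by norm_num) hz) ?_⟩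
  · refine ⟨(2 * B ^ 2 + |B| + 1)⁻¹, by positivity, fun z hz hzB => ?_⟩
    by_contra! hle
    have h1 := (PiLp.norm_apply_le ((ofCoeffs ![0, 0, 1] ![0, 1, 0] ![-Complex.I, 0, 0] 0).toFun z)
      1).trans hle
    have h2 := (PiLp.norm_apply_le ((ofCoeffs ![0, 0, 1] ![0, 1, 0] ![-Complex.I, 0, 0] 0).toFun z)
      2).trans hle
    rw [ofCoeffs_apply] at h1 h2
    have h3 : 2 * B ^ 2 + |B| + 1 < ‖z⁻¹‖ := by
      rw [norm_inv]; exact lt_inv_of_lt_inv₀ hz.1 hzB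
    have h4 : |(z⁻¹).re| ≤ B := by simpa [-Complex.inv_re] using h1
    have h5 : |((z⁻¹) ^ 2).re| ≤ B := by simpa [-inv_pow, ← inv_pow] using h2
    have h6 : ‖z⁻¹‖ ^ 2 = 2 * (z⁻¹).re ^ 2 - ((z⁻¹) ^ 2).re := by
      rw [← Complex.normSq_eq_norm_sq, Complex.normSq_apply, pow_two (z⁻¹), Complex.mul_re]
      ring
    have h7 : (z⁻¹).re ^ 2 ≤ B ^ 2 := sq_le_sq' (by linarith [(abs_le.1 h4).1]) (abs_le.1 h4).2
    have h8 : ‖z⁻¹‖ ^ 2 ≤ 2 * B ^ 2 + |B| := by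
      linarith [(abs_le.1 h5).1, le_abs_self B]
    nlinarith [sq_nonneg B, abs_nonneg B]
  · intro z hz w hw h
    have hz0 : z ≠ 0 := norm_pos_iff.1 hz.1
    have hw0 : w ≠ 0 := norm_pos_iff.1 hw.1
    have h0 := congrArg (fun x => x 0) h
    have h1 := congrArg (fun x => x 1) h
    have h2 := congrArg (fun x => x 2) h
    simp only [ofCoeffs_apply] at h0 h1 h2
    have e0 : z.im = w.im := by simpa using h0
    have e1 : (z⁻¹).re = (w⁻¹).re := by simpa using h1
    have e2 : ((z⁻¹) ^ 2).re = ((w⁻¹) ^ 2).re := by simpa [-inv_pow, ← inv_pow] using h2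
    have e3 : Complex.normSq z⁻¹ = Complex.normSq w⁻¹ := by
      rw [pow_two, pow_two, Complex.mul_re, Complex.mul_re, e1] at e2
      rw [Complex.normSq_apply, Complex.normSq_apply, e1]
      linarith
    rw [map_inv₀, map_inv₀, inv_inj] at e3
    rw [Complex.inv_re, Complex.inv_re, e3, div_left_inj' (by simpa using hw0)] at e1
    exact Complex.ext e1 e0
  · intro p hp
    have hz0 : z⁻¹ ≠ 0 := inv_ne_zero (norm_pos_iff.1 hz.1)
    generalize z⁻¹ = u at *
    have h0 : (-Complex.I * p * (u ^ 2)⁻¹).re = 0 := by simpa [-Complex.mul_re] using hp 0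
    have h1 : p.re = 0 := by simpa using hp 1
    have h2 := hp 2
    rw [re_mul_inv_eq_zero_iff (pow_ne_zero 2 hz0)] at h0
    simp [pow_two, h1] at h0 h2
    by_contra hp0
    have hq : p.im ≠ 0 := fun h => hp0 (Complex.ext h1 h)
    have h3 : u.im = 0 := by simpa [hq] using h2
    have h4 : u.re = 0 := by simpa [hq, h3] using h0
    exact hz0 (Complex.ext h4 h3)

/-! ### The list of types and the proof of the theorem. -/

theorem IsReduced.poleOrders_mem {e : MeromorphicEnd} (he : e.IsReduced)
    (h3 : e.poleOrders 2 = 3) :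
    e.poleOrders ∈ ({![2, 2, 3], ![1, 2, 3], ![0, 2, 3], ![0, 1, 3],
      ![2, 3, 3], ![1, 3, 3], ![0, 3, 3], ![0, 0, 3]} : Set (Fin 3 → ℕ)) := by
  have h01 : e.poleOrders 0 ≤ e.poleOrders 1 := he.1 (by decide)
  have h12 : e.poleOrders 1 ≤ e.poleOrders 2 := he.1 (by decide)
  have hle : ∀ k, e.poleOrders k ≤ 3 := fun k => h3 ▸ he.1 (Fin.le_last k)
  choose a b c h H hL _ using fun k => e.exists_hasExpansion (hle k)
  have hcombo : ∀ s : Fin 3 → ℝ, HasLaurent (e.combo s) (∑ k, s k * (-2 * a k))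
      (∑ k, s k * -b k) (∑ k, s k * c k) (fun z => ∑ k, s k * h k z) := HasLaurent.sum hL
  have h11 : ¬ (e.poleOrders 0 = 1 ∧ e.poleOrders 1 = 1) := by
    rintro ⟨h0, h1⟩
    have l0 := (hL 0).poleOrder_le_one_iff.1 h0.le
    have l1 := (hL 1).poleOrder_le_one_iff.1 h1.le
    have hc1 : c 1 ≠ 0 := by
      intro hc1
      have : e.poleOrders 1 ≤ 0 := (hL 1).poleOrder_le_zero_iff.2 ⟨l1.1, l1.2, by simp [hc1]⟩
      omega
    -- Real coefficients suffice to cancel the two residues, as these are real; the combination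
    -- would be holomorphic at the puncture.
    have hne : ![c 1, -c 0, 0] ≠ 0 := fun h => hc1 (congrFun h 0)
    have h4 := he.poleOrders_zero_le_combo hne
    have h5 := (hcombo ![c 1, -c 0, 0]).poleOrder_le_zero_iff.2 (by
      simp only [Fin.sum_univ_three, l0.1, l0.2, l1.1, l1.2]
      simp
      ring)
    omega
  have h33 : ¬ (e.poleOrders 0 = 3 ∧ e.poleOrders 1 = 3) := by
    rintro ⟨h0, -⟩
    -- A real linear map from dimension 3 to dimension 2 has a kernel, which gives a combination
    -- without third order pole.
    let T : (Fin 3 → ℝ) →ₗ[ℝ] ℂ := Fintype.linearCombination ℝ a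
    obtain ⟨s, hs, hs0⟩ := Submodule.exists_mem_ne_zero_of_ne_bot
      (T.ker_ne_bot_of_finrank_lt (by simp [Complex.finrank_real_complex]))
    have h4 := he.poleOrders_zero_le_combo hs0
    have hs : ∑ k, (s k : ℂ) * a k = 0 := by
      simpa [T, Fintype.linearCombination_apply] using hs
    have h5 := (hcombo s).poleOrder_le_two_iff.2 (by
      rw [Fin.sum_univ_three] at hs ⊢
      linear_combination -2 * hs)
    omega
  have heq : e.poleOrders = ![e.poleOrders 0, e.poleOrders 1, 3] := by
    ext k
    fin_cases k
    · rfl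
    · rfl
    · exact h3
  rw [heq]
  rw [h3] at h12
  generalize e.poleOrders 0 = x at *
  generalize e.poleOrders 1 = y at *
  simp only [Set.mem_insert_iff, Set.mem_singleton_iff, Matrix.vecCons_inj, and_true]
  omega

theorem isProperlyEmbedded_of_hasType {e : MeromorphicEnd} (he : e.HasType ![2, 2, 3]) :
    e.IsProperlyEmbedded := by
  obtain ⟨e', hee', hr, hn⟩ := he
  refine hee'.symm.isProperlyEmbedded ?_
  have n0 : e'.poleOrders 0 = 2 := congrFun hn 0
  have n1 : e'.poleOrders 1 = 2 := congrFun hn 1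
  have hle : ∀ k, e'.poleOrders k ≤ 3 := fun k => by rw [hn]; fin_cases k <;> simp
  choose a b c h H hL hH using fun k => e'.exists_hasExpansion (hle k)
  have a0 : a 0 = 0 := by simpa using (hL 0).poleOrder_le_two_iff.1 n0.le
  have a1 : a 1 = 0 := by simpa using (hL 1).poleOrder_le_two_iff.1 n1.le
  refine e'.isProperlyEmbedded_of_hasExpansion (a0 ▸ hH 0) (a1 ▸ hH 1) fun s t hst => ?_
  by_contra hne
  -- A real relation between the leading coefficients would produce a combination of pole order at
  -- most 1, against minimality of the first entry 2.
  have h1 := hr.poleOrders_zero_le_combo (s := ![s, t, 0]) fun h0 =>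
    hne ⟨congrFun h0 0, congrFun h0 1⟩
  have h2 := (HasLaurent.sum hL ![s, t, 0]).poleOrder_le_one_iff.2 (by
    simp [Fin.sum_univ_three, a0, a1]
    linear_combination -hst)
  exact absurd (n0.symm.le.trans (h1.trans h2)) (by norm_num)

theorem not_isInjective_of_hasType {e : MeromorphicEnd} {n : ℕ} (he : e.HasType ![n, 3, 3])
    (hn2 : n ≤ 2) : ¬ e.IsInjective := by
  obtain ⟨e', hee', hr, hn⟩ := he
  refine fun hi => ?_
  have n1 : e'.poleOrders 1 = 3 := congrFun hn 1
  have hle : ∀ k, e'.poleOrders k ≤ 3 := fun k => by rw [hn]; fin_cases k <;> simp; omega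
  choose a b c h H hL hH using fun k => e'.exists_hasExpansion (hle k)
  refine e'.not_isInjective_of_hasExpansion (hH 1) (hH 2) (fun s t hst => ?_)
    (hee'.isInjective hi)
  by_contra hne
  -- A relation here would lower the second entry below 3.
  have h1 := hr.poleOrders_one_le_combo (s := ![0, s, t]) (by
    rw [← not_and_or]; exact hne)
  have h2 := (HasLaurent.sum hL ![0, s, t]).poleOrder_le_two_iff.2 (by
    simp [Fin.sum_univ_three]
    linear_combination -2 * hst)
  exact absurd (n1.symm.le.trans (h1.trans h2)) (by norm_num)

theorem not_isProper_of_hasType {e : MeromorphicEnd} (he : e.HasType ![0, 0, 3]) :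
    ¬ e.IsProper := by
  obtain ⟨e', hee', hr, hn⟩ := he
  refine fun hp => ?_
  have n0 : e'.poleOrders 0 = 0 := congrFun hn 0
  have n1 : e'.poleOrders 1 = 0 := congrFun hn 1
  have n2 : e'.poleOrders 2 = 3 := congrFun hn 2
  have hle : ∀ k, e'.poleOrders k ≤ 3 := fun k => by rw [hn]; fin_cases k <;> simp
  choose a b c h H hL hH using fun k => e'.exists_hasExpansion (hle k)
  have hzero : ∀ k, e'.poleOrders k = 0 → HasExpansion (fun z => e'.toFun z k) 0 0 0 (H k) := by
    intro k hk
    have h1 := (hL k).poleOrder_le_zero_iff.1 hk.le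
    have e1 : a k = 0 := by simpa using h1.1
    have e2 : b k = 0 := by simpa using h1.2.1
    have e3 : c k = 0 := by simpa using h1.2.2
    have := hH k
    rwa [e1, e2, e3] at this
  refine e'.not_isProper_of_hasExpansion (hzero 0 n0) (hzero 1 n1) (hH 2) (fun ha => ?_)
    (hee'.isProper hp)
  have : e'.poleOrders 2 ≤ 2 := (hL 2).poleOrder_le_two_iff.2 (by simp [ha])
  omega

end MeromorphicEnd

open MeromorphicEnd in
theorem mainTheorem1 :
    -- every end of order 3 has exactly one type, which is one of the following eight
    (∀ e : MeromorphicEnd, e.HasOrder 3 →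
      ∃ t ∈ ({![2, 2, 3], ![1, 2, 3], ![0, 2, 3], ![0, 1, 3],
          ![2, 3, 3], ![1, 3, 3], ![0, 3, 3], ![0, 0, 3]} : Set (Fin 3 → ℕ)),
        e.HasType t ∧ ∀ t' : Fin 3 → ℕ, e.HasType t' → t' = t) ∧
    -- ends of type (2,2,3) exist, and all of them are properly embedded
    (∃ e : MeromorphicEnd, e.IsReduced ∧ e.poleOrders = ![2, 2, 3]) ∧
    (∀ e : MeromorphicEnd, e.HasType ![2, 2, 3] → e.IsProperlyEmbedded) ∧
    -- ends of type (1,2,3), (0,2,3), (0,1,3) can be properly embedded, but need not be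
    (∀ t ∈ ({![1, 2, 3], ![0, 2, 3], ![0, 1, 3]} : Set (Fin 3 → ℕ)),
      (∃ e : MeromorphicEnd, e.IsReduced ∧ e.poleOrders = t ∧ e.IsProperlyEmbedded) ∧
      (∃ e : MeromorphicEnd, e.IsReduced ∧ e.poleOrders = t ∧ ¬ e.IsProperlyEmbedded)) ∧
    -- ends of the remaining four types are never properly embedded
    (∀ t ∈ ({![2, 3, 3], ![1, 3, 3], ![0, 3, 3], ![0, 0, 3]} : Set (Fin 3 → ℕ)),
      ∀ e : MeromorphicEnd, e.HasType t → ¬ e.IsProperlyEmbedded) ∧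
    -- more precisely, the first three are never injective near the puncture, the last never proper
    (∀ t ∈ ({![2, 3, 3], ![1, 3, 3], ![0, 3, 3]} : Set (Fin 3 → ℕ)),
      ∀ e : MeromorphicEnd, e.HasType t → ¬ e.IsInjective) ∧
    (∀ e : MeromorphicEnd, e.HasType ![0, 0, 3] → ¬ e.IsProper) := by
  have hinj : ∀ t ∈ ({![2, 3, 3], ![1, 3, 3], ![0, 3, 3]} : Set (Fin 3 → ℕ)),
      ∀ e : MeromorphicEnd, e.HasType t → ¬ e.IsInjective := by
    rintro t (rfl | rfl | rfl) e he
    · exact not_isInjective_of_hasType he le_rfl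
    · exact not_isInjective_of_hasType he (by norm_num)
    · exact not_isInjective_of_hasType he (by norm_num)
  refine ⟨?_, ⟨_, isReduced_ofCoeffs_223⟩, fun e he => isProperlyEmbedded_of_hasType he, ?_, ?_,
    hinj, fun e he => not_isProper_of_hasType he⟩
  · rintro e ⟨t, ⟨e', hee', hr, rfl⟩, h3⟩
    have ht : e.HasType e'.poleOrders := ⟨e', hee', hr, rfl⟩
    exact ⟨_, hr.poleOrders_mem h3, ht, fun t' ht' => ht.unique ht'⟩
  · rintro t (rfl | rfl | rfl)
    · exact ⟨⟨_, (isReduced_ofCoeffs_123 _).1, (isReduced_ofCoeffs_123 _).2,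
          isProperlyEmbedded_ofCoeffs_123⟩,
        ⟨_, (isReduced_ofCoeffs_123 0).1, (isReduced_ofCoeffs_123 0).2,
          ofCoeffs_not_isProperlyEmbedded (by intro k; fin_cases k <;> simp)
            (by intro k; fin_cases k <;> simp) (by simp)⟩⟩
    · exact ⟨⟨_, (isReduced_ofCoeffs_023 _).1, (isReduced_ofCoeffs_023 _).2,
          isProperlyEmbedded_ofCoeffs_023⟩,
        ⟨_, (isReduced_ofCoeffs_023 1).1, (isReduced_ofCoeffs_023 1).2,
          ofCoeffs_not_isProperlyEmbedded (by intro k; fin_cases k <;> simp)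
            (by intro k; fin_cases k <;> simp) (by intro k; fin_cases k <;> simp)⟩⟩
    · exact ⟨⟨_, (isReduced_ofCoeffs_013 _).1, (isReduced_ofCoeffs_013 _).2,
          isProperlyEmbedded_ofCoeffs_013⟩,
        ⟨_, (isReduced_ofCoeffs_013 0).1, (isReduced_ofCoeffs_013 0).2,
          ofCoeffs_not_isProperlyEmbedded (by intro k; fin_cases k <;> simp)
            (by intro k; fin_cases k <;> simp) (by intro k; fin_cases k <;> simp)⟩⟩
  · rintro t (rfl | rfl | rfl | rfl) e he
    · exact fun h => hinj _ (by simp) e he h.isInjective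
    · exact fun h => hinj _ (by simp) e he h.isInjective
    · exact fun h => hinj _ (by simp) e he h.isInjective
    · exact fun h => not_isProper_of_hasType he h.isProper
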